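/- Let $n,d\ge 1$ be integers. For probability vectors $p_1,\dots,p_d\in\mathbb R^n$ with positive entries, $P=(p_1,\dots,p_d)$, let $U(P)$ be the set of contingency tensors of $P$: the tensors $U=[u_{i_1,\dots,i_d}]\in\otimes^d\mathbb R^n$ with nonnegative entries such that, for every $k\in\{1,\dots,d\}$ and $i\in\{1,\dots,n\}$, the sum of all entries $u_{i_1,\dots,i_d}$ with $i_k=i$ equals the $i$-th entry of $p_k$. For a cost tensor $C\in\otimes^d\mathbb R^n$ put $\langle C,U\rangle=\sum_{i_1,\dots,i_d}c_{i_1,\dots,i_d}u_{i_1,\dots,i_d}$ and $\tau(C,P)=\min\{\langle C,U\rangle: U\in U(P)\}$, and let $\omega$ be the difference between the maximum and the minimum entry of $C$. There are an absolute constant $K$ and a single algorithm which, for all $n,d\ge1$, all positive probability vectors $p_1,\dots,p_d\in\mathbb R^n$, all real $C\in\otimes^d\mathbb R^n$ and all $\delta>0$, given $(n,d,P,C,\delta)$ halts and outputs a tensor $B\in U(P)$ with $$\langle C,B\rangle\le\tau(C,P)+\delta .$$ If $n\ge2$, the number of operations that it performs is at most $$K\,\frac{\max(\omega,\delta)^3\,d^4\,n^{d+1}\log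 n}{\delta^3};$$ in particular, it is at most $K\,\omega^3d^4n^{d+1}\log n/\delta^3$ whenever $n\ge 2$ and $\delta\le\omega$. Here an algorithm is a program for a real random access machine: it works on registers holding natural numbers (counters and addresses) and on arrays of exact real numbers, with assignments, branching and while loops. Each constant, each register or memory access, each operation $+,-,\times$ on natural numbers, each operation $+,-,\times,/,\exp,\log$ on real numbers, each conversion of a natural number to a real one, each comparison, each negation of a test, each assignment and each branching or loop test counts as one operation. -/

import Mathlib

open scoped BigOperators

noncomputable section

namespace TOT

/-! ### Tensor optimal transport -/

/-- A real `d`-mode tensor with all modes of dimension `n`. -/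
abbrev Tensor (n d : ℕ) : Type := (Fin d → Fin n) → ℝ

/-- `p` is a probability vector all of whose entries are positive. -/
def IsPosProbVec {n : ℕ} (p : Fin n → ℝ) : Prop :=
  (∀ i, 0 < p i) ∧ ∑ i, p i = 1

/-- The Hilbert–Schmidt inner product of two tensors. -/
def inner {n d : ℕ} (C U : Tensor n d) : ℝ := ∑ x, C x * U x

/-- The `k`-th marginal of a tensor: the entry at `i` is the sum of all entries whose
`k`-th index equals `i`. -/
def marginal {n d : ℕ} (U : Tensor n d) (k : Fin d) (i : Fin n) : ℝ :=
  ∑ x : Fin d → Fin n with x k = i, U x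

/-- The set `U(P)` of contingency tensors: nonnegative tensors with marginals `P 0, …, P (d-1)`. -/
def contingency {n d : ℕ} (P : Fin d → Fin n → ℝ) : Set (Tensor n d) :=
  {U | (∀ x, 0 ≤ U x) ∧ ∀ k, marginal U k = P k}

/-- The value `τ(C, P)` of the tensor optimal transport problem (it is a minimum,
see `isLeast_value`). -/
def value {n d : ℕ} (C : Tensor n d) (P : Fin d → Fin n → ℝ) : ℝ :=
  sInf (inner C '' contingency P)

/-- The difference between the largest and the smallest entry of a tensor. -/
def spread {n d : ℕ} (C : Tensor n d) : ℝ := (⨆ x, C x) - (⨅ x, C x)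

theorem prod_mem_contingency {n d : ℕ} {P : Fin d → Fin n → ℝ} (hP : ∀ k, IsPosProbVec (P k)) :
    (fun x => ∏ k, P k (x k)) ∈ contingency P := by
  refine ⟨fun x => Finset.prod_nonneg fun k _ => ((hP k).1 _).le, fun k => ?_⟩
  funext i
  let f : Fin d → Fin n → ℝ := fun j y => if j = k then (if y = i then P k i else 0) else P j y
  have h1 : ∀ x : Fin d → Fin n,
      (if x k = i then ∏ j, P j (x j) else 0) = ∏ j, f j (x j) := by
    intro x
    by_cases hx : x k = i
    · rw [if_pos hx]
      refine Finset.prod_congr rfl fun j _ => ?_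
      by_cases hj : j = k
      · subst hj; simp [f, hx]
      · simp [f, hj]
    · rw [if_neg hx]
      refine (Finset.prod_eq_zero (Finset.mem_univ k) ?_).symm
      simp [f, hx]
  have h2 : ∑ x : Fin d → Fin n, ∏ j, f j (x j) = ∏ j, ∑ y, f j y := by
    rw [Finset.prod_univ_sum, Fintype.piFinset_univ]
  rw [marginal, Finset.sum_filter, Finset.sum_congr rfl fun x _ => h1 x, h2,
    Finset.prod_eq_single k]
  · simp [f]
  · intro j _ hj
    simp [f, hj, (hP j).2]
  · simp

theorem isCompact_contingency {n d : ℕ} (hd : 1 ≤ d) (P : Fin d → Fin n → ℝ) :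
    IsCompact (contingency P) := by
  have hclosed : IsClosed (contingency P) := by
    have h : contingency P = (⋂ x, {U : Tensor n d | 0 ≤ U x}) ∩
        ⋂ k, ⋂ i, {U : Tensor n d | marginal U k i = P k i} := by
      ext U; simp [contingency, funext_iff]
    rw [h]
    refine (isClosed_iInter fun x => isClosed_le continuous_const (continuous_apply x)).inter
      (isClosed_iInter fun k => isClosed_iInter fun i => isClosed_eq ?_ continuous_const)
    exact continuous_finsetSum _ fun x _ => continuous_apply x
  refine IsCompact.of_isClosed_subset
    (isCompact_univ_pi fun x : Fin d → Fin n => isCompact_Icc (a := (0 : ℝ))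
      (b := P ⟨0, hd⟩ (x ⟨0, hd⟩))) hclosed ?_
  intro U hU x _
  refine ⟨hU.1 x, ?_⟩
  rw [← hU.2 ⟨0, hd⟩]
  exact Finset.single_le_sum (f := U) (fun y _ => hU.1 y) (by simp)

theorem isLeast_value {n d : ℕ} (hd : 1 ≤ d) (C : Tensor n d) {P : Fin d → Fin n → ℝ}
    (hP : ∀ k, IsPosProbVec (P k)) : IsLeast (inner C '' contingency P) (value C P) := by
  refine IsCompact.isLeast_sInf ((isCompact_contingency hd P).image ?_)
    ⟨_, Set.mem_image_of_mem _ (prod_mem_contingency hP)⟩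
  exact continuous_finsetSum _ fun x _ => continuous_const.mul (continuous_apply x)

/-! ### Real random access machine

Programs act on natural-number registers (used for counters and addresses) and on arrays of
exact real numbers.  Every constant, register or memory access, arithmetic operation, `exp`,
`log`, comparison, assignment and branching costs one operation.  The only constants are
natural numbers, and no information flows from reals to naturals except through comparisons. -/

/-- A memory configuration: the registers, and the arrays (`mem a k` is cell `k` of array `a`). -/
structure State where
  reg : ℕ → ℕ
  mem : ℕ → ℕ → ℝ

/-- Expressions with natural-number values. -/
inductive NatExp where
  | const (c : ℕ)
  | reg (r : ℕ)
  | add (e f : NatExp)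
  | sub (e f : NatExp)
  | mul (e f : NatExp)

namespace NatExp

/-- The value of an expression (`sub` is truncated subtraction). -/
def eval (s : State) : NatExp → ℕ
  | const c => c
  | reg r => s.reg r
  | add e f => e.eval s + f.eval s
  | sub e f => e.eval s - f.eval s
  | mul e f => e.eval s * f.eval s

/-- The number of operations needed to evaluate an expression. -/
def cost : NatExp → ℕ
  | const _ => 1
  | reg _ => 1
  | add e f => e.cost + f.cost + 1
  | sub e f => e.cost + f.cost + 1
  | mul e f => e.cost + f.cost + 1

end NatExp

/-- Expressions with real values; `get a e` reads the cell of array `a` whose address is the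
value of `e`, and `ofNat e` converts a natural number to a real one. -/
inductive RealExp where
  | ofNat (e : NatExp)
  | get (a : ℕ) (e : NatExp)
  | add (e f : RealExp)
  | sub (e f : RealExp)
  | mul (e f : RealExp)
  | div (e f : RealExp)
  | exp (e : RealExp)
  | log (e : RealExp)

namespace RealExp

/-- The value of an expression.  Where division or the logarithm is undefined the value is the
conventional one (`x / 0 = 0`, `log 0 = 0`, `log x = log (-x)` for `x < 0`); a program can
detect these cases, and supply the same values, by comparisons with zero. -/
def eval (s : State) : RealExp → ℝ
  | ofNat e => (e.eval s : ℝ)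
  | get a e => s.mem a (e.eval s)
  | add e f => e.eval s + f.eval s
  | sub e f => e.eval s - f.eval s
  | mul e f => e.eval s * f.eval s
  | div e f => e.eval s / f.eval s
  | exp e => Real.exp (e.eval s)
  | log e => Real.log (e.eval s)

/-- The number of operations needed to evaluate an expression. -/
def cost : RealExp → ℕ
  | ofNat e => e.cost + 1
  | get _ e => e.cost + 1
  | add e f => e.cost + f.cost + 1
  | sub e f => e.cost + f.cost + 1
  | mul e f => e.cost + f.cost + 1
  | div e f => e.cost + f.cost + 1
  | exp e => e.cost + 1
  | log e => e.cost + 1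

end RealExp

/-- Conditions that a program can test. -/
inductive Test where
  | natLt (e f : NatExp)
  | realLt (e f : RealExp)
  | not (b : Test)

namespace Test

/-- The truth of a condition. -/
def Holds (s : State) : Test → Prop
  | natLt e f => e.eval s < f.eval s
  | realLt e f => e.eval s < f.eval s
  | not b => ¬ b.Holds s

/-- The number of operations needed to test a condition. -/
def cost : Test → ℕ
  | natLt e f => e.cost + f.cost + 1
  | realLt e f => e.cost + f.cost + 1
  | not b => b.cost + 1

end Test

/-- Programs: assignment to a register, assignment to the cell of array `a` at address `e`,
sequential composition, branching and while loops. -/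
inductive Prog where
  | setReg (r : ℕ) (e : NatExp)
  | setMem (a : ℕ) (e : NatExp) (f : RealExp)
  | seq (p q : Prog)
  | ite (b : Test) (p q : Prog)
  | loop (b : Test) (p : Prog)

/-- `Runs p s s' t`: started in `s`, the program `p` halts in `s'` after exactly `t` operations. -/
inductive Runs : Prog → State → State → ℕ → Prop where
  | setReg (r : ℕ) (e : NatExp) (s : State) :
      Runs (.setReg r e) s ⟨Function.update s.reg r (e.eval s), s.mem⟩ (e.cost + 1)
  | setMem (a : ℕ) (e : NatExp) (f : RealExp) (s : State) :
      Runs (.setMem a e f) s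
        ⟨s.reg, Function.update s.mem a (Function.update (s.mem a) (e.eval s) (f.eval s))⟩
        (e.cost + f.cost + 1)
  | seq {p q : Prog} {s₁ s₂ s₃ : State} {t u : ℕ} (hp : Runs p s₁ s₂ t) (hq : Runs q s₂ s₃ u) :
      Runs (.seq p q) s₁ s₃ (t + u)
  | iteTrue {b : Test} {p q : Prog} {s s' : State} {t : ℕ} (hb : b.Holds s) (hp : Runs p s s' t) :
      Runs (.ite b p q) s s' (b.cost + 1 + t)
  | iteFalse {b : Test} {p q : Prog} {s s' : State} {t : ℕ} (hb : ¬ b.Holds s)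
      (hq : Runs q s s' t) : Runs (.ite b p q) s s' (b.cost + 1 + t)
  | loopTrue {b : Test} {p : Prog} {s₁ s₂ s₃ : State} {t u : ℕ} (hb : b.Holds s₁)
      (hp : Runs p s₁ s₂ t) (hl : Runs (.loop b p) s₂ s₃ u) :
      Runs (.loop b p) s₁ s₃ (b.cost + 1 + t + u)
  | loopFalse {b : Test} {p : Prog} {s : State} (hb : ¬ b.Holds s) :
      Runs (.loop b p) s s (b.cost + 1)

/-- The machine is deterministic, so the final state and the operation count are determined. -/
theorem Runs.unique {p : Prog} {s s₁ s₂ : State} {t₁ t₂ : ℕ} (h₁ : Runs p s s₁ t₁)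
    (h₂ : Runs p s s₂ t₂) : s₁ = s₂ ∧ t₁ = t₂ := by
  induction h₁ generalizing s₂ t₂ with
  | setReg r e s => cases h₂; exact ⟨rfl, rfl⟩
  | setMem a e f s => cases h₂; exact ⟨rfl, rfl⟩
  | seq _ _ ih ih' =>
    cases h₂ with
    | seq hp hq =>
      obtain ⟨rfl, rfl⟩ := ih hp
      obtain ⟨rfl, rfl⟩ := ih' hq
      exact ⟨rfl, rfl⟩
  | iteTrue hb _ ih =>
    cases h₂ with
    | iteTrue _ hp => obtain ⟨rfl, rfl⟩ := ih hp; exact ⟨rfl, rfl⟩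
    | iteFalse hb' _ => exact absurd hb hb'
  | iteFalse hb _ ih =>
    cases h₂ with
    | iteTrue hb' _ => exact absurd hb' hb
    | iteFalse _ hp => obtain ⟨rfl, rfl⟩ := ih hp; exact ⟨rfl, rfl⟩
  | loopTrue hb _ _ ih ih' =>
    cases h₂ with
    | loopTrue _ hp hl =>
      obtain ⟨rfl, rfl⟩ := ih hp
      obtain ⟨rfl, rfl⟩ := ih' hl
      exact ⟨rfl, rfl⟩
    | loopFalse hb' => exact absurd hb hb'
  | loopFalse hb =>
    cases h₂ with
    | loopTrue hb' _ _ => exact absurd hb' hb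
    | loopFalse _ => exact ⟨rfl, rfl⟩

/-! ### Input and output conventions -/

/-- The address of a tensor entry in the array that stores the tensor. -/
def address {n d : ℕ} (x : Fin d → Fin n) : ℕ := ∑ j : Fin d, (x j : ℕ) * n ^ (j : ℕ)

/-- The state `s` holds the input `(n, d, P, C, δ)`: registers `0` and `1` hold `n` and `d`,
array `0` holds the vectors of `P` one after the other, array `1` the tensor `C`, and cell `0`
of array `2` the number `δ`.  Everything else is arbitrary. -/
structure IsInput {n d : ℕ} (s : State) (P : Fin d → Fin n → ℝ) (C : Tensor n d) (δ : ℝ) :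
    Prop where
  reg_zero : s.reg 0 = n
  reg_one : s.reg 1 = d
  vectors : ∀ (k : Fin d) (i : Fin n), s.mem 0 (k * n + i) = P k i
  cost : ∀ x : Fin d → Fin n, s.mem 1 (address x) = C x
  tolerance : s.mem 2 0 = δ

/-- The tensor that is stored in array `3`. -/
def output (n d : ℕ) (s : State) : Tensor n d := fun x => s.mem 3 (address x)

end TOT

end

open scoped BigOperators

noncomputable section

namespace TOT

/-! ### Marginals and rounding -/

variable {n d : ℕ}

/-! The method is entropic regularization: Sinkhorn scaling followed by rounding. Let ω be the
spread of `C`, `M = max ω δ`, and let η be of order d log n / δ. A Gibbs tensor, one obtained from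
exp (-η C) by scaling slices and having mass one, is nearly optimal for its own marginals: among
tensors with the same marginals the scalings contribute a constant, and Gibbs' inequality together
with the bound d log n on the entropy gives an excess cost of at most d log n / η
(`IsGibbs.inner_le`). It remains to find a Gibbs tensor whose marginals are close to `P` and to
repair them cheaply.

Repair: slices that are too heavy are shrunk, and the missing mass is restored by a rank-one tensor.
If every marginal has total excess at most ε, this raises the cost by at most ω d ε
(`inner_complete_shrink_le`). The same rounding carries an optimal tensor for `P` to the marginals
of the Gibbs tensor, so that the two can be compared (`inner_complete_shrink_le_value`).

Number of scalings: the cross entropy of the product coupling and the current tensor is nonnegative,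
is at most η ω + d log n at the start, and falls by exactly the relative entropy of the prescribed
and current marginals whenever a mode is matched (`IsGibbs.potential_matchMode`). Scaling only when
this relative entropy exceeds κ = ε², with ε = δ / (4 d M), makes each pass over the modes either
the last one or one that lowers the potential by more than κ. There are thus O(d³ log n (M/δ)³)
passes, and a Pinsker-type inequality (`sq_sum_max_le_relEntropy`) turns κ into ε at the end.

A pass takes O(d n^d) operations, because the digits of an address are maintained by carrying while
the array is traversed. The program is verified with time-bounded Hoare triples `Ends`, which also
record, through `Agree`, what a program leaves alone. -/

theorem sum_mul_mode (U : Tensor n d) (k : Fin d) (g : Fin n → ℝ) :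
    ∑ x, U x * g (x k) = ∑ i, marginal U k i * g i := by
  rw [← Finset.sum_fiberwise Finset.univ (fun x : Fin d → Fin n => x k)]
  refine Finset.sum_congr rfl fun i _ => ?_
  rw [marginal, Finset.sum_mul]
  refine Finset.sum_congr rfl fun x hx => ?_
  rw [(Finset.mem_filter.1 hx).2]

theorem sum_marginal (U : Tensor n d) (k : Fin d) : ∑ i, marginal U k i = ∑ x, U x := by
  simpa using (sum_mul_mode U k fun _ => 1).symm

theorem marginal_nonneg {U : Tensor n d} (hU : ∀ x, 0 ≤ U x) (k : Fin d) (i : Fin n) :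
    0 ≤ marginal U k i := Finset.sum_nonneg fun x _ => hU x

theorem marginal_pos {U : Tensor n d} (hU : ∀ x, 0 < U x) (k : Fin d) (i : Fin n) :
    0 < marginal U k i :=
  Finset.sum_pos (fun x _ => hU x) ⟨fun _ => i, by simp⟩

theorem marginal_mono {U V : Tensor n d} (h : ∀ x, U x ≤ V x) (k : Fin d) (i : Fin n) :
    marginal U k i ≤ marginal V k i := Finset.sum_le_sum fun x _ => h x

theorem marginal_prod (f : Fin d → Fin n → ℝ) (k : Fin d) (i : Fin n) :
    marginal (fun x => ∏ j, f j (x j)) k i =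
      f k i * ∏ j ∈ Finset.univ.erase k, ∑ y, f j y := by
  -- The condition `x k = i` is absorbed into the factor of mode `k`, so that the restricted sum
  -- becomes a full sum of products and factors.
  let g : Fin d → Fin n → ℝ := fun j y => if j = k then (if y = i then f k i else 0) else f j y
  have h1 : ∀ x : Fin d → Fin n,
      (if x k = i then ∏ j, f j (x j) else 0) = ∏ j, g j (x j) := by
    intro x
    by_cases hx : x k = i
    · rw [if_pos hx]
      refine Finset.prod_congr rfl fun j _ => ?_
      by_cases hj : j = k
      · subst hj; simp [g, hx]
      · simp [g, hj]
    · rw [if_neg hx]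
      refine (Finset.prod_eq_zero (Finset.mem_univ k) ?_).symm
      simp [g, hx]
  have h2 : ∑ x : Fin d → Fin n, ∏ j, g j (x j) = ∏ j, ∑ y, g j y := by
    rw [Finset.prod_univ_sum, Fintype.piFinset_univ]
  rw [marginal, Finset.sum_filter, Finset.sum_congr rfl fun x _ => h1 x, h2,
    ← Finset.mul_prod_erase _ _ (Finset.mem_univ k)]
  congr 1
  · simp [g]
  · refine Finset.prod_congr rfl fun j hj => ?_
    simp [g, Finset.ne_of_mem_erase hj]

/-- Multiply each slice `x k = i` of a tensor by `f i`. -/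
def scaleMode (k : Fin d) (f : Fin n → ℝ) (A : Tensor n d) : Tensor n d :=
  fun x => A x * f (x k)

theorem marginal_scaleMode (k : Fin d) (f : Fin n → ℝ) (A : Tensor n d) (i : Fin n) :
    marginal (scaleMode k f A) k i = marginal A k i * f i := by
  rw [marginal, marginal, Finset.sum_mul]
  refine Finset.sum_congr rfl fun x hx => ?_
  rw [scaleMode, (Finset.mem_filter.1 hx).2]

/-- Shrink the slices of the first modes, one mode after the other, so that the marginals do not
exceed those prescribed. -/
def shrink (P : Fin d → Fin n → ℝ) (A : Tensor n d) : ℕ → Tensor n d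
  | 0 => A
  | k + 1 => if h : k < d then
      scaleMode ⟨k, h⟩ (fun i => min 1 (P ⟨k, h⟩ i / marginal (shrink P A k) ⟨k, h⟩ i))
        (shrink P A k)
    else shrink P A k

theorem shrink_nonneg {P : Fin d → Fin n → ℝ} (hP : ∀ k i, 0 ≤ P k i) {A : Tensor n d}
    (hA : ∀ x, 0 ≤ A x) (k : ℕ) (x : Fin d → Fin n) : 0 ≤ shrink P A k x := by
  induction k generalizing x with
  | zero => exact hA x
  | succ k ih =>
    rw [shrink]
    split_ifs with h
    · exact mul_nonneg (ih x) (le_min zero_le_one (div_nonneg (hP _ _) (marginal_nonneg ih _ _)))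
    · exact ih x

theorem shrink_succ_le {P : Fin d → Fin n → ℝ} (hP : ∀ k i, 0 ≤ P k i) {A : Tensor n d}
    (hA : ∀ x, 0 ≤ A x) (k : ℕ) (x : Fin d → Fin n) :
    shrink P A (k + 1) x ≤ shrink P A k x := by
  rw [shrink]
  split_ifs with h
  · exact mul_le_of_le_one_right (shrink_nonneg hP hA k x) (min_le_left _ _)
  · exact le_rfl

theorem shrink_antitone {P : Fin d → Fin n → ℝ} (hP : ∀ k i, 0 ≤ P k i) {A : Tensor n d}
    (hA : ∀ x, 0 ≤ A x) (x : Fin d → Fin n) : Antitone fun k => shrink P A k x :=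
  antitone_nat_of_succ_le fun k => shrink_succ_le hP hA k x

/-- For `r = 0` the convention `p / 0 = 0` makes both sides zero, so empty slices need no separate
treatment in the program. -/
theorem mul_min_one_div {r p : ℝ} (hr : 0 ≤ r) (hp : 0 ≤ p) : r * min 1 (p / r) = min r p := by
  rcases hr.eq_or_lt with rfl | hr
  · simp [hp]
  · rw [mul_min_of_nonneg _ _ hr.le, mul_one, mul_div_cancel₀ _ hr.ne']

theorem marginal_shrink_succ {P : Fin d → Fin n → ℝ} (hP : ∀ k i, 0 ≤ P k i) {A : Tensor n d}
    (hA : ∀ x, 0 ≤ A x) (k : Fin d) (i : Fin n) :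
    marginal (shrink P A (k + 1)) k i = min (marginal (shrink P A k) k i) (P k i) := by
  rw [shrink, dif_pos k.2, marginal_scaleMode]
  exact mul_min_one_div (marginal_nonneg (shrink_nonneg hP hA k) _ _) (hP _ _)

/-- The bound reached when mode `k` is treated survives, since later shrinkings only lower entries.
-/
theorem marginal_shrink_le {P : Fin d → Fin n → ℝ} (hP : ∀ k i, 0 ≤ P k i) {A : Tensor n d}
    (hA : ∀ x, 0 ≤ A x) (k : Fin d) (i : Fin n) : marginal (shrink P A d) k i ≤ P k i :=
  (marginal_mono (fun x => shrink_antitone hP hA x (show (k : ℕ) + 1 ≤ d from k.2)) k i).trans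
    ((marginal_shrink_succ hP hA k i).trans_le (min_le_right _ _))

/-- Treating a mode removes exactly the excess of its current marginal. Entries have only decreased
so far, hence this is no more than the excess in `A`, at most `ε` per mode. -/
theorem sum_sub_shrink_le {P : Fin d → Fin n → ℝ} (hP : ∀ k i, 0 ≤ P k i) {A : Tensor n d}
    (hA : ∀ x, 0 ≤ A x) {ε : ℝ} (hε : ∀ k, ∑ i, max (marginal A k i - P k i) 0 ≤ ε)
    (k : ℕ) (hk : k ≤ d) : ∑ x, A x - ∑ x, shrink P A k x ≤ k * ε := by
  induction k with
  | zero => simp [shrink]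
  | succ k ih =>
    have h := ih (by omega)
    let k' : Fin d := ⟨k, hk⟩
    have h2 : ∑ x, shrink P A k x - ∑ x, shrink P A (k + 1) x ≤ ε := by
      rw [← sum_marginal _ k', ← sum_marginal _ k', ← Finset.sum_sub_distrib]
      refine le_trans (Finset.sum_le_sum fun i _ => ?_) (hε k')
      rw [marginal_shrink_succ hP hA k' i]
      have h3 : marginal (shrink P A k) k' i ≤ marginal A k' i :=
        marginal_mono (fun x => shrink_antitone hP hA x (Nat.zero_le k)) k' i
      rcases min_cases (marginal (shrink P A k) k' i) (P k' i) with h | h <;>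
        rcases max_cases (marginal A k' i - P k' i) 0 with h' | h' <;> simp only [k'] at * <;>
        linarith
    push_cast
    linarith

/-- Add to a tensor the multiple of a rank-one tensor that corrects its marginals. -/
def complete (P : Fin d → Fin n → ℝ) (A : Tensor n d) : Tensor n d := fun x =>
  A x + (1 - ∑ y, A y) * ∏ k, (P k (x k) - marginal A k (x k)) / (1 - ∑ y, A y)

/-- The defects of all marginals have the same total, the missing mass. Divided by it they become
probability vectors, so in each marginal of their product the other factors sum to one and the
defect itself is left. -/
theorem complete_mem (hd : 1 ≤ d) {P : Fin d → Fin n → ℝ} (hP : ∀ k, ∑ i, P k i = 1)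
    {A : Tensor n d} (hA : ∀ x, 0 ≤ A x) (hle : ∀ k i, marginal A k i ≤ P k i) :
    complete P A ∈ contingency P := by
  have hsum : ∀ k, ∑ i, (P k i - marginal A k i) = 1 - ∑ y, A y := fun k => by
    rw [Finset.sum_sub_distrib, hP, sum_marginal]
  have hm : 0 ≤ 1 - ∑ y, A y := by
    rw [← hsum ⟨0, hd⟩]
    exact Finset.sum_nonneg fun i _ => sub_nonneg.2 (hle _ _)
  refine ⟨fun x => add_nonneg (hA x) (mul_nonneg hm (Finset.prod_nonneg fun k _ =>
    div_nonneg (sub_nonneg.2 (hle _ _)) hm)), fun k => ?_⟩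
  funext i
  have h1 : marginal (complete P A) k i = marginal A k i + (1 - ∑ y, A y) *
      marginal (fun x => ∏ j, (P j (x j) - marginal A j (x j)) / (1 - ∑ y, A y)) k i := by
    simp only [marginal, complete, Finset.sum_add_distrib, Finset.mul_sum]
  rw [h1, marginal_prod (fun j y => (P j y - marginal A j y) / (1 - ∑ y, A y))]
  -- If no mass is missing, the nonnegative defects sum to zero and vanish, while the correction is
  -- multiplied by zero.
  rcases hm.eq_or_lt with h0 | hpos
  · have h2 : P k i - marginal A k i = 0 :=
      (Finset.sum_eq_zero_iff_of_nonneg fun i _ => sub_nonneg.2 (hle k i)).1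
        ((hsum k).trans h0.symm) i (Finset.mem_univ i)
    rw [← h0]
    linarith
  · rw [Finset.prod_eq_one]
    · field_simp
      ring
    · intro j _
      rw [← Finset.sum_div, hsum, div_self hpos.ne']

theorem sum_of_mem_contingency (hd : 1 ≤ d) {P : Fin d → Fin n → ℝ} (hP : ∀ k, ∑ i, P k i = 1)
    {U : Tensor n d} (hU : U ∈ contingency P) : ∑ x, U x = 1 := by
  rw [← sum_marginal U ⟨0, hd⟩, hU.2, hP]

theorem sub_le_spread (C : Tensor n d) (x y : Fin d → Fin n) : C x - C y ≤ spread C :=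
  sub_le_sub (le_ciSup (Set.finite_range C).bddAbove x) (ciInf_le (Set.finite_range C).bddBelow y)

theorem exists_forall_le_apply (hn : 1 ≤ n) (C : Tensor n d) : ∃ y, ∀ x, C y ≤ C x := by
  have : Nonempty (Fin n) := ⟨⟨0, hn⟩⟩
  exact Finite.exists_min C

/-- The rounded tensor and `A` both dominate the shrunk tensor and have equal mass. Measured from
the smallest cost, removing mass gains, and each unit of restored mass costs at most the spread; at
most `d * ε` is restored. -/
theorem inner_complete_shrink_le (hn : 1 ≤ n) (hd : 1 ≤ d) {P : Fin d → Fin n → ℝ}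
    (hP : ∀ k i, 0 ≤ P k i) (hP1 : ∀ k, ∑ i, P k i = 1) (C : Tensor n d) {A : Tensor n d}
    (hA : ∀ x, 0 ≤ A x) (hA1 : ∑ x, A x = 1) {ε : ℝ}
    (hε : ∀ k, ∑ i, max (marginal A k i - P k i) 0 ≤ ε) :
    inner C (complete P (shrink P A d)) ≤ inner C A + spread C * (d * ε) := by
  obtain ⟨y, hy⟩ := exists_forall_le_apply hn C
  have hS := shrink_nonneg hP hA d
  have hle := marginal_shrink_le hP hA
  have hmem := complete_mem hd hP1 hS hle
  have hB1 := sum_of_mem_contingency hd hP1 hmem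
  have hm : 1 - ∑ x, shrink P A d x ≤ d * ε := hA1 ▸ sum_sub_shrink_le hP hA hε d le_rfl
  have hspread : 0 ≤ spread C := by simpa using sub_le_spread C y y
  -- The middle term, with the constant factor `C y`, disappears on summation because both masses
  -- are one.
  have key : ∀ x, C x * complete P (shrink P A d) x ≤ C x * A x
      + C y * (complete P (shrink P A d) x - A x)
      + spread C * (complete P (shrink P A d) x - shrink P A d x) := by
    intro x
    have h1 : shrink P A d x ≤ A x := shrink_antitone hP hA x (Nat.zero_le d)
    have h2 : shrink P A d x ≤ complete P (shrink P A d) x := by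
      have h3 : ∀ k i, 0 ≤ P k i - marginal (shrink P A d) k i := fun k i => sub_nonneg.2 (hle k i)
      have h4 : 0 ≤ 1 - ∑ x, shrink P A d x := by
        rw [← hP1 ⟨0, hd⟩, ← sum_marginal _ ⟨0, hd⟩, ← Finset.sum_sub_distrib]
        exact Finset.sum_nonneg fun i _ => h3 _ _
      have h5 := mul_nonneg h4 (Finset.prod_nonneg fun k (_ : k ∈ Finset.univ) =>
        div_nonneg (h3 k (x k)) h4)
      simp only [complete]
      linarith
    nlinarith [mul_nonneg (sub_nonneg.2 (hy x)) (sub_nonneg.2 h1),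
      mul_nonneg (sub_nonneg.2 (sub_le_spread C x y)) (sub_nonneg.2 h2)]
  have h6 := Finset.sum_le_sum fun x (_ : x ∈ Finset.univ) => key x
  rw [Finset.sum_add_distrib, Finset.sum_add_distrib, ← Finset.mul_sum, ← Finset.mul_sum,
    Finset.sum_sub_distrib, Finset.sum_sub_distrib, hB1, hA1, sub_self, mul_zero, add_zero] at h6
  exact h6.trans (add_le_add le_rfl (mul_le_mul_of_nonneg_left hm hspread))

/-! ### Relative entropy -/

/-- The relative entropy of two positive vectors. -/
def relEntropy (p r : Fin n → ℝ) : ℝ := ∑ i, p i * Real.log (p i / r i)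

/-- A weak Pinsker inequality through the Hellinger distance. The bound log t ≤ t - 1 at t = √(r/p)
gives ∑ (√r - √p)² ≤ `relEntropy p r`. Cauchy–Schwarz applied to |r - p| = |√r - √p| (√r + √p), with
∑ (√r + √p)² ≤ 4, bounds the squared ℓ¹ distance by four times the entropy; the positive and
negative parts of r - p each carry half of that distance. -/
theorem sq_sum_max_le_relEntropy {p r : Fin n → ℝ} (hp : ∀ i, 0 < p i) (hr : ∀ i, 0 < r i)
    (hp1 : ∑ i, p i = 1) (hr1 : ∑ i, r i = 1) :
    (∑ i, max (r i - p i) 0) ^ 2 ≤ relEntropy p r ∧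
      (∑ i, max (p i - r i) 0) ^ 2 ≤ relEntropy p r := by
  have hell : ∑ i, |√(r i) - √(p i)| ^ 2 ≤ relEntropy p r := by
    have h1 : ∀ i, |√(r i) - √(p i)| ^ 2 ≤ p i * Real.log (p i / r i) + (r i - p i) := by
      intro i
      have hsp := Real.sqrt_pos.2 (hp i)
      have hsr := Real.sqrt_pos.2 (hr i)
      have h2 := Real.log_le_sub_one_of_pos (div_pos hsr hsp)
      rw [Real.log_div hsr.ne' hsp.ne', Real.log_sqrt (hr i).le, Real.log_sqrt (hp i).le] at h2
      rw [Real.log_div (hp i).ne' (hr i).ne', sq_abs]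
      have h3 := mul_le_mul_of_nonneg_left h2 (hp i).le
      have h4 : p i * (√(r i) / √(p i) - 1) = √(p i) * √(r i) - p i := by
        have h5 : p i / √(p i) = √(p i) := Real.div_sqrt
        linear_combination √(r i) * h5
      nlinarith [Real.mul_self_sqrt (hp i).le, Real.mul_self_sqrt (hr i).le]
    refine (Finset.sum_le_sum fun i _ => h1 i).trans_eq ?_
    rw [Finset.sum_add_distrib, Finset.sum_sub_distrib, hp1, hr1, relEntropy]
    ring
  have hcs := Finset.sum_mul_sq_le_sq_mul_sq Finset.univ (fun i => |√(r i) - √(p i)|)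
    (fun i => √(r i) + √(p i))
  have h5 : ∑ i, (√(r i) + √(p i)) ^ 2 ≤ 4 := by
    have : ∀ i, (√(r i) + √(p i)) ^ 2 ≤ 2 * r i + 2 * p i := fun i => by
      nlinarith [Real.mul_self_sqrt (hp i).le, Real.mul_self_sqrt (hr i).le,
        sq_nonneg (√(r i) - √(p i))]
    refine (Finset.sum_le_sum fun i _ => this i).trans_eq ?_
    rw [Finset.sum_add_distrib, ← Finset.mul_sum, ← Finset.mul_sum, hp1, hr1]
    norm_num
  have h6 : ∀ i, |√(r i) - √(p i)| * (√(r i) + √(p i)) = |r i - p i| := by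
    intro i
    rw [← abs_of_nonneg (add_nonneg (Real.sqrt_nonneg (r i)) (Real.sqrt_nonneg (p i))), ← abs_mul]
    congr 1
    nlinarith [Real.mul_self_sqrt (hp i).le, Real.mul_self_sqrt (hr i).le]
  simp only [h6] at hcs
  have h7 : (∑ i, |r i - p i|) ^ 2 ≤ 4 * relEntropy p r := by
    have h0 : 0 ≤ ∑ i, |√(r i) - √(p i)| ^ 2 := Finset.sum_nonneg fun i _ => sq_nonneg _
    nlinarith
  have h8 : ∑ i, max (r i - p i) 0 = (∑ i, |r i - p i|) / 2 := by
    have : ∀ i, max (r i - p i) 0 = |r i - p i| / 2 + (r i - p i) / 2 := fun i => by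
      rcases max_cases (r i - p i) 0 with h | h <;> rcases abs_cases (r i - p i) with h' | h' <;>
        linarith
    simp only [this]
    rw [Finset.sum_add_distrib, ← Finset.sum_div, ← Finset.sum_div, Finset.sum_sub_distrib,
      hp1, hr1]
    ring
  have h9 : ∑ i, max (p i - r i) 0 = (∑ i, |r i - p i|) / 2 := by
    have : ∀ i, max (p i - r i) 0 = |r i - p i| / 2 - (r i - p i) / 2 := fun i => by
      rcases max_cases (p i - r i) 0 with h | h <;> rcases abs_cases (r i - p i) with h' | h' <;>
        linarith
    simp only [this]
    rw [Finset.sum_sub_distrib, ← Finset.sum_div, ← Finset.sum_div, Finset.sum_sub_distrib,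
      hp1, hr1]
    ring
  rw [h8, h9]
  constructor <;> nlinarith

/-- Gibbs' inequality, termwise from log t ≤ t - 1 at t = b/a; terms with `a i = 0` are harmless
because the left side vanishes there. A uniform `b` yields the bound on the entropy, a Gibbs tensor
the comparison of costs. -/
theorem sum_mul_log_le {ι : Type*} [Fintype ι] {a b : ι → ℝ} (ha : ∀ i, 0 ≤ a i)
    (hb : ∀ i, 0 < b i) (h : ∑ i, b i ≤ ∑ i, a i) :
    ∑ i, a i * Real.log (b i) ≤ ∑ i, a i * Real.log (a i) := by
  have key : ∀ i, a i * Real.log (b i) ≤ a i * Real.log (a i) + (b i - a i) := by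
    intro i
    rcases (ha i).eq_or_lt with h0 | hpos
    · simp [← h0, (hb i).le]
    · have h1 := mul_le_mul_of_nonneg_left
        (Real.log_le_sub_one_of_pos (div_pos (hb i) hpos)) hpos.le
      rw [Real.log_div (hb i).ne' hpos.ne'] at h1
      have h2 : a i * (b i / a i - 1) = b i - a i := by field_simp
      linarith
  have h1 := Finset.sum_le_sum fun i (_ : i ∈ Finset.univ) => key i
  rw [Finset.sum_add_distrib, Finset.sum_sub_distrib] at h1
  linarith

theorem sum_mul_log_nonpos {ι : Type*} [Fintype ι] {a : ι → ℝ} (ha : ∀ i, 0 ≤ a i)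
    (h : ∑ i, a i = 1) : ∑ i, a i * Real.log (a i) ≤ 0 :=
  Finset.sum_nonpos fun i _ => mul_nonpos_of_nonneg_of_nonpos (ha i)
    (Real.log_nonpos (ha i) (h ▸ Finset.single_le_sum (fun j _ => ha j) (Finset.mem_univ i)))

theorem neg_log_card_le_sum_mul_log {ι : Type*} [Fintype ι] {a : ι → ℝ} (ha : ∀ i, 0 ≤ a i)
    (h : ∑ i, a i = 1) : -Real.log (Fintype.card ι) ≤ ∑ i, a i * Real.log (a i) := by
  have hne : Nonempty ι := by
    by_contra hne
    rw [not_nonempty_iff] at hne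
    simp at h
  have hc : (0 : ℝ) < Fintype.card ι := by exact_mod_cast Fintype.card_pos
  have h1 := sum_mul_log_le (b := fun _ => (Fintype.card ι : ℝ)⁻¹) ha (fun _ => inv_pos.2 hc)
    (by simp [h, hc.ne'])
  rwa [← Finset.sum_mul, h, one_mul, Real.log_inv] at h1

/-! ### Gibbs tensors -/

/-- Positive tensors of total mass one that arise from `exp (-η C)` by scaling slices. -/
structure IsGibbs (η : ℝ) (C A : Tensor n d) : Prop where
  pos : ∀ x, 0 < A x
  sum_eq_one : ∑ x, A x = 1
  log_eq : ∃ (c : ℝ) (l : Fin d → Fin n → ℝ), ∀ x, Real.log (A x) = c - η * C x + ∑ k, l k (x k)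

theorem IsGibbs.sum_marginal_eq_one {η : ℝ} {C A : Tensor n d} (hA : IsGibbs η C A) (k : Fin d) :
    ∑ i, marginal A k i = 1 := by rw [sum_marginal, hA.sum_eq_one]

/-- One Sinkhorn step. -/
def matchMode (P : Fin d → Fin n → ℝ) (k : Fin d) (A : Tensor n d) : Tensor n d :=
  scaleMode k (fun i => P k i / marginal A k i) A

theorem IsGibbs.matchMode {η : ℝ} {C A : Tensor n d} (hA : IsGibbs η C A)
    {P : Fin d → Fin n → ℝ} (hP : ∀ k, IsPosProbVec (P k)) (k : Fin d) :
    IsGibbs η C (matchMode P k A) := by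
  have hf : ∀ i, 0 < P k i / marginal A k i := fun i =>
    div_pos ((hP k).1 i) (marginal_pos hA.pos k i)
  refine ⟨fun x => mul_pos (hA.pos x) (hf _), ?_, ?_⟩
  · rw [← sum_marginal _ k, ← (hP k).2]
    refine Finset.sum_congr rfl fun i _ => ?_
    rw [TOT.matchMode, marginal_scaleMode, mul_div_cancel₀ _ (marginal_pos hA.pos k i).ne']
  · obtain ⟨c, l, h⟩ := hA.log_eq
    refine ⟨c, fun j i => l j i + if j = k then Real.log (P k i / marginal A k i) else 0,
      fun x => ?_⟩
    rw [TOT.matchMode, scaleMode, Real.log_mul (hA.pos x).ne' (hf _).ne', h,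
      Finset.sum_add_distrib, Finset.sum_ite_eq' Finset.univ k]
    simp
    ring

/-- The cross entropy of the product coupling and a tensor. -/
def potential (P : Fin d → Fin n → ℝ) (A : Tensor n d) : ℝ :=
  -∑ x, (∏ k, P k (x k)) * Real.log (A x)

/-- Entries of a tensor of mass one are at most one. This lower bound is what makes the scaling
stop. -/
theorem IsGibbs.potential_nonneg {η : ℝ} {C A : Tensor n d} (hA : IsGibbs η C A)
    {P : Fin d → Fin n → ℝ} (hP : ∀ k, IsPosProbVec (P k)) : 0 ≤ potential P A := by
  refine neg_nonneg.2 (Finset.sum_nonpos fun x _ => mul_nonpos_of_nonneg_of_nonpos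
    (Finset.prod_nonneg fun k _ => ((hP k).1 _).le) (Real.log_nonpos (hA.pos x).le ?_))
  rw [← hA.sum_eq_one]
  exact Finset.single_le_sum (fun j _ => (hA.pos j).le) (Finset.mem_univ x)

/-- The logarithm changes by a function of `x k` alone, and the average of that function over the
product coupling only involves its `k`-th marginal, which is `P k`. Nothing else about the product
is used: it is merely an explicit member of `contingency P`. -/
theorem IsGibbs.potential_matchMode {η : ℝ} {C A : Tensor n d} (hA : IsGibbs η C A)
    {P : Fin d → Fin n → ℝ} (hP : ∀ k, IsPosProbVec (P k)) (k : Fin d) :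
    potential P (TOT.matchMode P k A) = potential P A - relEntropy (P k) (marginal A k) := by
  have hf : ∀ i, 0 < P k i / marginal A k i := fun i =>
    div_pos ((hP k).1 i) (marginal_pos hA.pos k i)
  have h1 : ∀ x, Real.log (TOT.matchMode P k A x) =
      Real.log (A x) + Real.log (P k (x k) / marginal A k (x k)) := fun x =>
    Real.log_mul (hA.pos x).ne' (hf _).ne'
  simp only [potential, h1, mul_add, Finset.sum_add_distrib]
  rw [sum_mul_mode (fun x => ∏ k, P k (x k)) k (fun i => Real.log (P k i / marginal A k i)),
    (prod_mem_contingency hP).2 k, relEntropy]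
  ring

/-- The tensor proportional to `exp (-η C)` of total mass one. -/
def gibbsStart (η : ℝ) (C : Tensor n d) : Tensor n d :=
  fun x => Real.exp (0 - η * C x) / ∑ y, Real.exp (0 - η * C y)

theorem sum_exp_pos (hn : 1 ≤ n) (η : ℝ) (C : Tensor n d) :
    0 < ∑ y, Real.exp (0 - η * C y) :=
  Finset.sum_pos (fun _ _ => Real.exp_pos _) ⟨fun _ => ⟨0, hn⟩, Finset.mem_univ _⟩

theorem log_gibbsStart (hn : 1 ≤ n) (η : ℝ) (C : Tensor n d) (x : Fin d → Fin n) :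
    Real.log (gibbsStart η C x) = -Real.log (∑ y, Real.exp (0 - η * C y)) - η * C x := by
  rw [gibbsStart, Real.log_div (Real.exp_pos _).ne' (sum_exp_pos hn η C).ne', Real.log_exp]
  ring

theorem isGibbs_gibbsStart (hn : 1 ≤ n) (η : ℝ) (C : Tensor n d) :
    IsGibbs η C (gibbsStart η C) := by
  refine ⟨fun x => div_pos (Real.exp_pos _) (sum_exp_pos hn η C), ?_,
    -Real.log (∑ y, Real.exp (0 - η * C y)), fun _ _ => 0, fun x => ?_⟩
  · simp only [gibbsStart]
    rw [← Finset.sum_div, div_self (sum_exp_pos hn η C).ne']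
  · rw [log_gibbsStart hn]
    simp

/-- The normalizing sum has n^d terms, each at most exp (-η min C), so every -log entry is already
at most the right-hand side; then average. -/
theorem potential_gibbsStart_le (hn : 1 ≤ n) (hd : 1 ≤ d) {η : ℝ} (hη : 0 ≤ η) (C : Tensor n d)
    {P : Fin d → Fin n → ℝ} (hP : ∀ k, IsPosProbVec (P k)) :
    potential P (gibbsStart η C) ≤ η * spread C + d * Real.log n := by
  obtain ⟨y, hy⟩ := exists_forall_le_apply hn C
  have hZ : Real.log (∑ z, Real.exp (0 - η * C z)) ≤ d * Real.log n - η * C y := by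
    have h0 : d * Real.log n - η * C y = Real.log ((n : ℝ) ^ d * Real.exp (-(η * C y))) := by
      rw [Real.log_mul (by positivity) (Real.exp_pos _).ne', Real.log_pow, Real.log_exp,
        sub_eq_add_neg]
    rw [h0]
    refine Real.log_le_log (sum_exp_pos hn η C) ?_
    have h1 := Finset.sum_le_card_nsmul (Finset.univ : Finset (Fin d → Fin n))
      (fun z => Real.exp (0 - η * C z)) (Real.exp (-(η * C y))) fun z _ =>
        Real.exp_le_exp.2 (by nlinarith [mul_le_mul_of_nonneg_left (hy z) hη])
    simpa using h1
  have hsum := sum_of_mem_contingency hd (fun k => (hP k).2) (prod_mem_contingency hP)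
  have h2 : ∀ x, (∏ k, P k (x k)) * -Real.log (gibbsStart η C x) ≤
      (∏ k, P k (x k)) * (η * spread C + d * Real.log n) := by
    intro x
    refine mul_le_mul_of_nonneg_left ?_ (Finset.prod_nonneg fun k _ => ((hP k).1 _).le)
    rw [log_gibbsStart hn]
    nlinarith [mul_le_mul_of_nonneg_left (sub_le_spread C x y) hη]
  have h3 := Finset.sum_le_sum fun x (_ : x ∈ Finset.univ) => h2 x
  rw [← Finset.sum_mul, hsum, one_mul] at h3
  simpa [potential] using h3

/-- Since log A is c - η C plus functions of single coordinates, the sums of X log A and A log A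
differ by exactly η times the difference of costs when `X` shares the marginals of `A`. The first
sum is at most ∑ X log X ≤ 0, the second at least -d log n. -/
theorem IsGibbs.inner_le {η : ℝ} (hη : 0 < η) {C A X : Tensor n d} (hA : IsGibbs η C A)
    (hX : X ∈ contingency (marginal A)) (hX1 : ∑ x, X x = 1) :
    inner C A ≤ inner C X + d * Real.log n / η := by
  obtain ⟨c, l, h⟩ := hA.log_eq
  have h1 : ∀ Y : Tensor n d, ∑ x, Y x = 1 → (∀ k, marginal Y k = marginal A k) →
      ∑ x, Y x * Real.log (A x) = c - η * inner C Y + ∑ k, ∑ i, marginal A k i * l k i := by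
    intro Y hY1 hY
    have h2 : ∀ x, Y x * Real.log (A x) =
        Y x * c - η * (C x * Y x) + ∑ k, Y x * l k (x k) := fun x => by
      rw [h, ← Finset.mul_sum]; ring
    simp only [h2]
    rw [Finset.sum_add_distrib, Finset.sum_sub_distrib, ← Finset.sum_mul, hY1, ← Finset.mul_sum,
      Finset.sum_comm, inner, one_mul]
    congr 1
    exact Finset.sum_congr rfl fun k _ => by rw [sum_mul_mode, hY]
  have h3 := h1 X hX1 hX.2
  have h4 := h1 A hA.sum_eq_one fun _ => rfl
  have h5 := sum_mul_log_le hX.1 hA.pos (by rw [hX1, hA.sum_eq_one])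
  have h6 := sum_mul_log_nonpos hX.1 hX1
  have h7 := neg_log_card_le_sum_mul_log (fun x => (hA.pos x).le) hA.sum_eq_one
  have h8 : Real.log (Fintype.card (Fin d → Fin n)) = d * Real.log n := by simp
  rw [h8] at h7
  rw [← sub_le_iff_le_add', le_div_iff₀ hη]
  nlinarith

/-- The tolerance is spent as δ/4 for rounding `A` to the marginals `P`, δ/4 for rounding an optimal
tensor to the marginals of `A`, and δ/2 for the entropy. Taking `M` at least `δ` keeps κ meaningful
when `C` is constant. -/
theorem inner_complete_shrink_le_value (hn : 1 ≤ n) (hd : 1 ≤ d) {P : Fin d → Fin n → ℝ}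
    (hP : ∀ k, IsPosProbVec (P k)) {C A : Tensor n d} {η κ M δ : ℝ} (hδ : 0 < δ)
    (hη : η = 2 * (d * Real.log (n + 1)) / δ) (hM : M = max (spread C) δ)
    (hκ : κ = (δ / (4 * (d * M))) ^ 2) (hA : IsGibbs η C A)
    (hent : ∀ k, relEntropy (P k) (marginal A k) ≤ κ) :
    inner C (complete P (shrink P A d)) ≤ value C P + δ := by
  have hn' : (1 : ℝ) ≤ n := by exact_mod_cast hn
  have hd' : (1 : ℝ) ≤ d := by exact_mod_cast hd
  have hlog : 0 < Real.log (n + 1) := Real.log_pos (by linarith)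
  have hη0 : 0 < η := by rw [hη]; positivity
  have hMδ : δ ≤ M := hM ▸ le_max_right _ _
  have hM0 : 0 < M := hδ.trans_le hMδ
  have hεpos : 0 ≤ δ / (4 * (d * M)) := by positivity
  have hA0 : ∀ x, 0 ≤ A x := fun x => (hA.pos x).le
  have hε : ∀ k, ∑ i, max (marginal A k i - P k i) 0 ≤ δ / (4 * (d * M)) ∧
      ∑ i, max (P k i - marginal A k i) 0 ≤ δ / (4 * (d * M)) := fun k => by
    have h := sq_sum_max_le_relEntropy (hP k).1 (marginal_pos hA.pos k) (hP k).2
      (hA.sum_marginal_eq_one k)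
    rw [hκ] at hent
    exact ⟨abs_le_of_sq_le_sq' (h.1.trans (hent k)) hεpos |>.2,
      abs_le_of_sq_le_sq' (h.2.trans (hent k)) hεpos |>.2⟩
  have hsp : spread C * (d * (δ / (4 * (d * M)))) ≤ δ / 4 := by
    have h1 : (d : ℝ) * (δ / (4 * (d * M))) = δ / 4 / M := by field_simp
    rw [h1, mul_div_assoc', div_le_iff₀ hM0, mul_comm]
    exact mul_le_mul_of_nonneg_left (hM ▸ le_max_left _ _) (by positivity)
  have h1 := inner_complete_shrink_le hn hd (fun k i => ((hP k).1 i).le) (fun k => (hP k).2) C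
    hA0 hA.sum_eq_one fun k => (hε k).1
  obtain ⟨⟨U, hU, hUv⟩, -⟩ := isLeast_value hd C hP
  have hU1 := sum_of_mem_contingency hd (fun k => (hP k).2) hU
  -- The rounding is now applied in the opposite direction, to the optimal `U` with the marginals of
  -- `A` as target; this tensor occurs only in the proof and is never computed.
  have h2 := inner_complete_shrink_le hn hd (marginal_nonneg hA0) hA.sum_marginal_eq_one C
    hU.1 hU1 (ε := δ / (4 * (d * M))) fun k => by rw [hU.2]; exact (hε k).2
  have hX := complete_mem hd hA.sum_marginal_eq_one (shrink_nonneg (marginal_nonneg hA0) hU.1 d)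
    (marginal_shrink_le (marginal_nonneg hA0) hU.1)
  have h3 := hA.inner_le hη0 hX (sum_of_mem_contingency hd hA.sum_marginal_eq_one hX)
  -- Using log (n + 1) instead of log n keeps η positive for n = 1 and only helps here.
  have h4 : d * Real.log n / η ≤ δ / 2 := by
    rw [div_le_iff₀ hη0, hη]
    have h5 : Real.log n ≤ Real.log (n + 1) := Real.log_le_log (by linarith) (by linarith)
    have h6 : δ / 2 * (2 * (d * Real.log (n + 1)) / δ) = d * Real.log (n + 1) := by field_simp
    rw [h6]
    exact mul_le_mul_of_nonneg_left h5 (by linarith)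
  rw [← hUv]
  linarith

/-! ### Verification of programs -/

/-- The state with register `r` set to `v`. -/
def State.setR (s : State) (r v : ℕ) : State := ⟨Function.update s.reg r v, s.mem⟩

@[simp] theorem State.setR_mem (s : State) (r v : ℕ) : (s.setR r v).mem = s.mem := rfl

@[simp] theorem State.setR_reg (s : State) (r v q : ℕ) :
    (s.setR r v).reg q = if q = r then v else s.reg q := by
  simp [State.setR, Function.update_apply]

namespace Prog

/-- The effect of a program without loops. -/
def exec : Prog → State → State
  | setReg r e, s => s.setR r (e.eval s)
  | setMem a e f, s =>
    ⟨s.reg, Function.update s.mem a (Function.update (s.mem a) (e.eval s) (f.eval s))⟩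
  | seq p q, s => q.exec (p.exec s)
  | ite b p q, s => open Classical in if b.Holds s then p.exec s else q.exec s
  | loop _ _, s => s

/-- A program has no loops. -/
def LoopFree : Prog → Prop
  | setReg _ _ => True
  | setMem _ _ _ => True
  | seq p q => p.LoopFree ∧ q.LoopFree
  | ite _ p q => p.LoopFree ∧ q.LoopFree
  | loop _ _ => False

/-- A bound for the number of operations of a program without loops. -/
def maxCost : Prog → ℕ
  | setReg _ e => e.cost + 1
  | setMem _ e f => e.cost + f.cost + 1
  | seq p q => p.maxCost + q.maxCost
  | ite b p q => b.cost + 1 + (p.maxCost + q.maxCost)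
  | loop _ _ => 0

/-- The registers that a program may change. -/
def regs : Prog → List ℕ
  | setReg r _ => [r]
  | setMem _ _ _ => []
  | seq p q => p.regs ++ q.regs
  | ite _ p q => p.regs ++ q.regs
  | loop _ p => p.regs

/-- The arrays that a program may change. -/
def arrays : Prog → List ℕ
  | setReg _ _ => []
  | setMem a _ _ => [a]
  | seq p q => p.arrays ++ q.arrays
  | ite _ p q => p.arrays ++ q.arrays
  | loop _ p => p.arrays

end Prog

/-- Two states agree outside the registers in `R` and the arrays in `L`. -/
structure Agree (R L : List ℕ) (s s' : State) : Prop where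
  reg : ∀ r, r ∉ R → s'.reg r = s.reg r
  mem : ∀ a, a ∉ L → s'.mem a = s.mem a

theorem Agree.refl (R L : List ℕ) (s : State) : Agree R L s s := ⟨fun _ _ => rfl, fun _ _ => rfl⟩

theorem Agree.trans {R L : List ℕ} {s₁ s₂ s₃ : State} (h : Agree R L s₁ s₂)
    (h' : Agree R L s₂ s₃) : Agree R L s₁ s₃ :=
  ⟨fun r hr => (h'.reg r hr).trans (h.reg r hr), fun a ha => (h'.mem a ha).trans (h.mem a ha)⟩

theorem Agree.mono {R L R' L' : List ℕ} {s s' : State} (h : Agree R L s s')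
    (hR : R ⊆ R') (hL : L ⊆ L') : Agree R' L' s s' :=
  ⟨fun r hr => h.reg r fun h' => hr (hR h'), fun a ha => h.mem a fun h' => ha (hL h')⟩

theorem Agree.setR {R L : List ℕ} {s s' : State} (h : Agree R L s s') {r : ℕ} (hr : r ∈ R)
    (v : ℕ) : Agree R L s (s'.setR r v) :=
  ⟨fun q hq => by
    rw [State.setR_reg, if_neg (by rintro rfl; exact hq hr), h.reg q hq], h.mem⟩

/-- Targets of assignments are literal register and array numbers, so the possible changes can be
read off the text of the program; later frame conditions are therefore settled by `decide`. -/
theorem Runs.agree {p : Prog} {s s' : State} {t : ℕ} (h : Runs p s s' t) :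
    Agree p.regs p.arrays s s' := by
  induction h with
  | setReg r e s =>
    exact ⟨fun q hq => Function.update_of_ne (by simpa [Prog.regs] using hq) _ _, fun _ _ => rfl⟩
  | setMem a e f s =>
    exact ⟨fun _ _ => rfl,
      fun q hq => Function.update_of_ne (by simpa [Prog.arrays] using hq) _ _⟩
  | seq _ _ ih ih' =>
    exact (ih.mono (List.subset_append_left _ _) (List.subset_append_left _ _)).trans
      (ih'.mono (List.subset_append_right _ _) (List.subset_append_right _ _))
  | iteTrue _ _ ih => exact ih.mono (List.subset_append_left _ _) (List.subset_append_left _ _)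
  | iteFalse _ _ ih => exact ih.mono (List.subset_append_right _ _) (List.subset_append_right _ _)
  | loopTrue _ _ _ ih ih' => exact ih.trans ih'
  | loopFalse _ => exact .refl _ _ _

/-- Started in `s`, the program `p` halts within `T` operations in a state that satisfies `Q`. -/
def Ends (p : Prog) (s : State) (T : ℕ) (Q : State → Prop) : Prop :=
  ∃ s' t, Runs p s s' t ∧ t ≤ T ∧ Q s'

theorem Ends.mono {p : Prog} {s : State} {T T' : ℕ} {Q Q' : State → Prop} (h : Ends p s T Q)
    (hT : T ≤ T') (hQ : ∀ s', Agree p.regs p.arrays s s' → Q s' → Q' s') : Ends p s T' Q' := by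
  obtain ⟨s', t, hr, ht, hq⟩ := h
  exact ⟨s', t, hr, ht.trans hT, hQ s' hr.agree hq⟩

theorem Ends.mono_time {p : Prog} {s : State} {T T' : ℕ} {Q : State → Prop} (h : Ends p s T Q)
    (hT : T ≤ T') : Ends p s T' Q :=
  h.mono hT fun _ _ h => h

theorem Ends.seq {p q : Prog} {s : State} {T U : ℕ} {Q R : State → Prop} (hp : Ends p s T R)
    (hq : ∀ s', Agree p.regs p.arrays s s' → R s' → Ends q s' U Q) :
    Ends (.seq p q) s (T + U) Q := by
  obtain ⟨s', t, hr, ht, hR⟩ := hp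
  obtain ⟨s'', u, hr', hu, hQ⟩ := hq s' hr.agree hR
  exact ⟨s'', t + u, .seq hr hr', add_le_add ht hu, hQ⟩

theorem Ends.ite {b : Test} {p q : Prog} {s : State} {T : ℕ} {Q : State → Prop}
    (hp : b.Holds s → Ends p s T Q) (hq : ¬ b.Holds s → Ends q s T Q) :
    Ends (.ite b p q) s (b.cost + 1 + T) Q := by
  by_cases hb : b.Holds s
  · obtain ⟨s', t, hr, ht, hQ⟩ := hp hb
    exact ⟨s', _, .iteTrue hb hr, by omega, hQ⟩
  · obtain ⟨s', t, hr, ht, hQ⟩ := hq hb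
    exact ⟨s', _, .iteFalse hb hr, by omega, hQ⟩

theorem Ends.exec {p : Prog} (hp : p.LoopFree) (s : State) :
    Ends p s p.maxCost (fun s' => s' = p.exec s) := by
  induction p generalizing s with
  | setReg r e => exact ⟨_, _, .setReg r e s, le_rfl, rfl⟩
  | setMem a e f => exact ⟨_, _, .setMem a e f s, le_rfl, rfl⟩
  | seq p q ihp ihq =>
    exact (ihp hp.1 s).seq fun s' _ h => (ihq hp.2 s').mono le_rfl fun s'' _ h' => by
      rw [h', h, Prog.exec]
  | ite b p q ihp ihq =>
    refine .ite (fun hb => (ihp hp.1 s).mono (Nat.le_add_right _ _) fun s' _ h => ?_)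
      (fun hb => (ihq hp.2 s).mono (Nat.le_add_left _ _) fun s' _ h => ?_)
    · rw [h, Prog.exec, if_pos hb]
    · rw [h, Prog.exec, if_neg hb]
  | loop b p => exact hp.elim

theorem Ends.straight {p : Prog} {s : State} {T : ℕ} {Q : State → Prop} (hp : p.LoopFree)
    (hT : p.maxCost ≤ T) (hQ : Q (p.exec s)) : Ends p s T Q :=
  (Ends.exec hp s).mono hT fun _ _ h => h ▸ hQ

/-- A loop terminates if each of its rounds decreases the rank `m` of the state. -/
theorem Ends.loop {b : Test} {p : Prog} {T : ℕ} (J : ℕ → State → Prop)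
    (hstep : ∀ m s, J m s → b.Holds s → Ends p s T fun s' => ∃ m' < m, J m' s') (m : ℕ) (s : State)
    (h : J m s) :
    Ends (.loop b p) s (m * (b.cost + 1 + T) + (b.cost + 1))
      (fun s' => ¬ b.Holds s' ∧ ∃ m', J m' s') := by
  induction m using Nat.strong_induction_on generalizing s with
  | _ m ih =>
    by_cases hb : b.Holds s
    · obtain ⟨s', t, hr, ht, m', hm, hJ⟩ := hstep m s h hb
      obtain ⟨s'', u, hr', hu, hQ⟩ := ih m' hm s' hJ
      refine ⟨s'', _, .loopTrue hb hr hr', ?_, hQ⟩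
      obtain ⟨j, rfl⟩ := Nat.exists_eq_add_of_lt hm
      have h1 : (m' + j + 1) * (b.cost + 1 + T) =
          m' * (b.cost + 1 + T) + j * (b.cost + 1 + T) + (b.cost + 1 + T) := by ring
      have h2 := Nat.zero_le (j * (b.cost + 1 + T))
      omega
    · exact ⟨s, _, .loopFalse hb, by omega, hb, m, h⟩

/-- `for r < reg b do p`. -/
def Prog.forReg (r b : ℕ) (p : Prog) : Prog :=
  .seq (.setReg r (.const 0))
    (.loop (.natLt (.reg r) (.reg b)) (.seq p (.setReg r (.add (.reg r) (.const 1)))))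

/-- The rank is the number of rounds left. A round costs 4 for the test, 4 for the increment and `T`
for the body; the 6 pays for the initialization and the last test. The invariant is asserted after
the counter has been advanced. -/
theorem Ends.forReg {r b : ℕ} {p : Prog} {s : State} {N T : ℕ} (I : ℕ → State → Prop)
    (hN : s.reg b = N) (hrb : b ≠ r) (hr : r ∉ p.regs) (hb : b ∉ p.regs)
    (h0 : I 0 (s.setR r 0))
    (hstep : ∀ i s', i < N → Agree (Prog.forReg r b p).regs (Prog.forReg r b p).arrays s s' →
      s'.reg r = i → I i s' → Ends p s' T fun s'' => I (i + 1) (s''.setR r (i + 1))) :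
    Ends (.forReg r b p) s (N * (T + 8) + 6) (I N) := by
  let J : ℕ → State → Prop := fun m s' =>
    Agree (Prog.forReg r b p).regs (Prog.forReg r b p).arrays s s' ∧ s'.reg r + m = N ∧
      I (s'.reg r) s'
  have hrmem : r ∈ (Prog.forReg r b p).regs := by simp [Prog.forReg, Prog.regs]
  have hbmem : b ∉ (Prog.forReg r b p).regs := by simp [Prog.forReg, Prog.regs, hrb, hb]
  have hl := Ends.loop (b := .natLt (.reg r) (.reg b))
    (p := .seq p (.setReg r (.add (.reg r) (.const 1)))) (T := T + 4) J ?_ N (s.setR r 0)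
    ⟨(Agree.refl _ _ s).setR hrmem 0, by simp, by simpa using h0⟩
  · have h1 : Ends (.setReg r (.const 0)) s 2 (fun s' => s' = s.setR r 0) :=
      Ends.straight trivial le_rfl rfl
    refine (h1.seq (U := N * (3 + 1 + (T + 4)) + (3 + 1)) (Q := I N) fun s' _ h => ?_).mono
      (by ring_nf; exact le_rfl) fun _ _ h => h
    rw [h]
    refine hl.mono le_rfl ?_
    rintro s'' - ⟨hge, m, hag, hm, hI⟩
    simp only [Test.Holds, NatExp.eval, hag.reg b hbmem, hN] at hge
    have : s''.reg r = N := by omega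
    exact this ▸ hI
  · rintro m s' ⟨hag, hm, hI⟩ hlt
    simp only [Test.Holds, NatExp.eval, hag.reg b hbmem, hN] at hlt
    refine (hstep _ s' hlt hag rfl hI).seq fun s'' hag' hI' =>
      Ends.straight trivial le_rfl ⟨m - 1, by omega, ?_⟩
    have h2 : s''.reg r = s'.reg r := hag'.reg r hr
    have h3 : (Prog.setReg r (.add (.reg r) (.const 1))).exec s'' =
        s''.setR r (s'.reg r + 1) := by
      simp [Prog.exec, NatExp.eval, h2]
    rw [h3]
    refine ⟨(hag.trans (hag'.mono ?_ ?_)).setR hrmem _, ?_, ?_⟩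
    · simp [Prog.forReg, Prog.regs]
    · simp [Prog.forReg, Prog.arrays]
    · simp only [State.setR_reg, if_true]; omega
    · simpa using hI'

/-- Run through the addresses `a < reg 2` in register `5`, keeping `a % reg 4` in register `6` and
`a / reg 4 % reg 0` in register `7`. -/
def Prog.walk (p : Prog) : Prog :=
  .seq (.setReg 6 (.const 0)) <| .seq (.setReg 7 (.const 0)) <| .forReg 5 2 <| .seq p <|
    .seq (.setReg 6 (.add (.reg 6) (.const 1))) <|
    .ite (.natLt (.reg 6) (.reg 4)) (.setReg 6 (.reg 6)) <|
    .seq (.setReg 6 (.const 0)) <| .seq (.setReg 7 (.add (.reg 7) (.const 1))) <|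
    .ite (.natLt (.reg 7) (.reg 0)) (.setReg 6 (.reg 6)) (.setReg 7 (.const 0))

theorem succ_mod_of_lt {a w : ℕ} (h : a % w + 1 < w) :
    (a + 1) % w = a % w + 1 ∧ (a + 1) / w = a / w := by
  have hw : 0 < w := by omega
  have h1 : a + 1 = (a % w + 1) + w * (a / w) := by have := Nat.mod_add_div a w; omega
  constructor
  · rw [h1, Nat.add_mul_mod_self_left, Nat.mod_eq_of_lt h]
  · rw [h1, Nat.add_mul_div_left _ _ hw, Nat.div_eq_of_lt h, zero_add]

theorem succ_mod_of_le {a w : ℕ} (hw : 0 < w) (h : w ≤ a % w + 1) :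
    (a + 1) % w = 0 ∧ (a + 1) / w = a / w + 1 := by
  have h2 := Nat.mod_lt a hw
  have h1 : a + 1 = w * (a / w + 1) := by
    have := Nat.mod_add_div a w
    rw [mul_add, mul_one]; omega
  constructor
  · rw [h1, Nat.mul_mod_right]
  · rw [h1, Nat.mul_div_cancel_left _ hw]

/-- The machine has no integer division, so the remainder and the digit are kept up to date by
carrying: constant overhead per address. -/
theorem Ends.walk {p : Prog} {s : State} {n N w T : ℕ} (I : ℕ → (ℕ → ℕ → ℝ) → Prop)
    (hn : 0 < n) (hw : 0 < w) (h0 : s.reg 0 = n) (h2 : s.reg 2 = N) (h4 : s.reg 4 = w)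
    (hp : p.LoopFree) (hT : p.maxCost ≤ T) (hregs : p.regs = []) (hI0 : I 0 s.mem)
    (hstep : ∀ a s', a < N → Agree [5, 6, 7] p.arrays s s' → s'.reg 5 = a →
      s'.reg 7 = a / w % n → I a s'.mem → I (a + 1) (p.exec s').mem) :
    Ends (.walk p) s (N * (T + 34) + 10) (fun s' => I N s'.mem) := by
  let K : ℕ → State → Prop := fun a s' => s'.reg 6 = a % w ∧ s'.reg 7 = a / w % n ∧ I a s'.mem
  have key := Ends.seq (p := .setReg 6 (.const 0)) (s := s) (T := 2)
    (R := fun s' => s' = s.setR 6 0) (Ends.straight trivial le_rfl rfl) fun s₁ _ e₁ =>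
    Ends.seq (p := .setReg 7 (.const 0)) (s := s₁) (T := 2)
    (R := fun s' => s' = (s.setR 6 0).setR 7 0)
    (Ends.straight trivial le_rfl (e₁ ▸ rfl)) fun s₂ _ e₂ =>
    Ends.forReg (r := 5) (b := 2) (s := s₂) (N := N) (T := T + 26) K
    (p := .seq p <|
    .seq (.setReg 6 (.add (.reg 6) (.const 1))) <|
    .ite (.natLt (.reg 6) (.reg 4)) (.setReg 6 (.reg 6)) <|
    .seq (.setReg 6 (.const 0)) <| .seq (.setReg 7 (.add (.reg 7) (.const 1))) <|
    .ite (.natLt (.reg 7) (.reg 0)) (.setReg 6 (.reg 6)) (.setReg 7 (.const 0)))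
    (by simp [e₂, h2]) (by decide) (by simp [Prog.regs, hregs]) (by simp [Prog.regs, hregs])
    (by simp [K, e₂, hI0]) ?_
  · exact key.mono (by rw [Nat.add_assoc T]; omega) fun s' _ h => h.2.2
  · rintro a s' ha hag h5 ⟨h6, h7, hI⟩
    have hag' : Agree [5, 6, 7] p.arrays s s' := by
      subst e₂
      have := ((Agree.refl [5, 6, 7] p.arrays s).setR (r := 6) (by decide) 0).setR
        (r := 7) (by decide) 0
      refine this.trans (hag.mono ?_ ?_)
      · simp [Prog.forReg, Prog.regs, hregs]
      · simp [Prog.forReg, Prog.arrays]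
    refine (Ends.exec hp s').mono hT (fun _ _ h => h) |>.seq (U := 26) fun s'' hag'' e => ?_
    rw [hregs] at hag''
    have hr : ∀ q, s''.reg q = s'.reg q := fun q => hag''.reg q (by simp)
    have hmem := hstep a s' ha hag' h5 h7 hI
    rw [← e] at hmem
    refine Ends.straight (by simp [Prog.LoopFree]) (by decide) ?_
    have e0 : s''.reg 0 = n := by rw [hr, hag'.reg 0 (by decide), h0]
    have e4 : s''.reg 4 = w := by rw [hr, hag'.reg 4 (by decide), h4]
    have e6 : s''.reg 6 = a % w := by rw [hr, h6]
    have e7 : s''.reg 7 = a / w % n := by rw [hr, h7]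
    by_cases c : a % w + 1 < w
    · obtain ⟨c1, c2⟩ := succ_mod_of_lt c
      simp [K, Prog.exec, NatExp.eval, Test.Holds, e4, e6, e7, c, c1, c2, hmem]
    · obtain ⟨c1, c2⟩ := succ_mod_of_le hw (not_lt.1 c)
      by_cases c' : a / w % n + 1 < n
      · obtain ⟨c3, -⟩ := succ_mod_of_lt c'
        simp [K, Prog.exec, NatExp.eval, Test.Holds, e0, e4, e6, e7, c, c1, c2, c', c3, hmem]
      · obtain ⟨c3, -⟩ := succ_mod_of_le hn (not_lt.1 c')
        simp [K, Prog.exec, NatExp.eval, Test.Holds, e0, e4, e6, e7, c, c1, c2, c', c3, hmem]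

/-- Run through the modes `k < reg 1` in register `3`, keeping `reg 0 ^ k` in register `4`. -/
def Prog.modes (p : Prog) : Prog :=
  .seq (.setReg 4 (.const 1)) <| .forReg 3 1 <| .seq p (.setReg 4 (.mul (.reg 4) (.reg 0)))

/-- Besides the memory the invariant sees register `8`, where a Sinkhorn pass records whether some
mode has been scaled. -/
theorem Ends.modes {p : Prog} {s : State} {n d T : ℕ} (I : ℕ → ℕ → (ℕ → ℕ → ℝ) → Prop)
    (h0 : s.reg 0 = n) (h1 : s.reg 1 = d)
    (hr : 0 ∉ p.regs ∧ 1 ∉ p.regs ∧ 3 ∉ p.regs ∧ 4 ∉ p.regs) (hI0 : I 0 (s.reg 8) s.mem)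
    (hstep : ∀ k s', k < d → Agree (3 :: 4 :: p.regs) p.arrays s s' → s'.reg 3 = k →
      s'.reg 4 = n ^ k → I k (s'.reg 8) s'.mem →
      Ends p s' T fun s'' => I (k + 1) (s''.reg 8) s''.mem) :
    Ends (.modes p) s (d * (T + 12) + 8)
      (fun s' => s'.reg 4 = n ^ d ∧ I d (s'.reg 8) s'.mem) := by
  let K : ℕ → State → Prop := fun k s' => s'.reg 4 = n ^ k ∧ I k (s'.reg 8) s'.mem
  have key := Ends.seq (p := .setReg 4 (.const 1)) (s := s) (T := 2)
    (R := fun s' => s' = s.setR 4 1) (Ends.straight trivial le_rfl rfl) fun s₁ _ e₁ =>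
    Ends.forReg (r := 3) (b := 1) (s := s₁) (N := d) (T := T + 4) K
    (p := .seq p (.setReg 4 (.mul (.reg 4) (.reg 0))))
    (by simp [e₁, h1]) (by decide) (by simp [Prog.regs, hr]) (by simp [Prog.regs, hr])
    (by simp [K, e₁, hI0]) ?_
  · exact key.mono (by rw [Nat.add_assoc T]; omega) fun s' _ h => h
  · rintro k s' hk hag h3 ⟨h4, hI⟩
    have hag' : Agree (3 :: 4 :: p.regs) p.arrays s s' := by
      subst e₁
      refine ((Agree.refl (3 :: 4 :: p.regs) p.arrays s).setR (r := 4) (by simp) 1).trans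
        (hag.mono ?_ ?_)
      · simp [Prog.forReg, Prog.regs]
      · simp [Prog.forReg, Prog.arrays]
    refine (hstep k s' hk hag' h3 h4 hI).seq fun s'' hag'' hI' =>
      Ends.straight trivial le_rfl ?_
    have e0 : s''.reg 0 = n := by
      rw [hag''.reg 0 hr.1, hag'.reg 0 (by simp [hr]), h0]
    have e4 : s''.reg 4 = n ^ k := by rw [hag''.reg 4 hr.2.2.2, h4]
    simp [K, Prog.exec, NatExp.eval, e0, e4, pow_succ, hI']

/-! ### Elementary loops -/

/-- The invariant also says that cells not yet reached are unchanged, so the body may use the old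
content of the cell that it overwrites. -/
theorem Ends.fill {r b A : ℕ} {p : Prog} {s : State} {N T : ℕ} (v : ℕ → ℝ) (hN : s.reg b = N)
    (hrb : b ≠ r) (hp : p.LoopFree) (hregs : p.regs = []) (hA : p.arrays ⊆ [A])
    (hT : N * (p.maxCost + 8) + 6 ≤ T)
    (hv : ∀ i s', i < N → Agree [r] [A] s s' → s'.reg r = i → s'.mem A i = s.mem A i →
      (p.exec s').mem A = Function.update (s'.mem A) i (v i)) :
    Ends (.forReg r b p) s T (fun s' => ∀ i < N, s'.mem A i = v i) := by
  refine (Ends.forReg (T := p.maxCost)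
    (fun i s' => (∀ j < i, s'.mem A j = v j) ∧ ∀ j, i ≤ j → s'.mem A j = s.mem A j) hN hrb
    (by simp [hregs]) (by simp [hregs]) ⟨by simp, by simp⟩ ?_).mono hT fun s' _ h => h.1
  rintro i s' hi hag hr ⟨h1, h2⟩
  refine Ends.straight hp le_rfl ?_
  have hag' : Agree [r] [A] s s' := by
    refine hag.mono ?_ ?_
    · simp [Prog.forReg, Prog.regs, hregs]
    · simpa [Prog.forReg, Prog.arrays] using hA
  rw [State.setR_mem, hv i s' hi hag' hr (h2 i le_rfl)]
  refine ⟨fun j hj => ?_, fun j hj => ?_⟩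
  · rcases (Nat.lt_succ_iff.1 hj).eq_or_lt with rfl | hlt
    · simp
    · rw [Function.update_of_ne hlt.ne, h1 j hlt]
  · rw [Function.update_of_ne (by omega), h2 j (by omega)]

/-- Add the values of `e` to cell `0` of array `A`. -/
def Prog.accum (r b A : ℕ) (e : RealExp) : Prog :=
  .forReg r b (.setMem A (.const 0) (.add (.get A (.const 0)) e))

theorem Ends.accum {r b A : ℕ} {e : RealExp} {s : State} {N T : ℕ} (v : ℕ → ℝ) (hN : s.reg b = N)
    (hrb : b ≠ r) (hT : N * (e.cost + 13) + 6 ≤ T)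
    (hv : ∀ i s', i < N → Agree [r] [A] s s' → s'.reg r = i → e.eval s' = v i) :
    Ends (.accum r b A e) s T
      (fun s' => s'.mem A 0 = s.mem A 0 + ∑ i ∈ Finset.range N, v i) := by
  refine (Ends.forReg (T := e.cost + 5)
    (fun i s' => s'.mem A 0 = s.mem A 0 + ∑ j ∈ Finset.range i, v j) hN hrb
    (by simp [Prog.regs]) (by simp [Prog.regs]) (by simp) ?_).mono (by rwa [Nat.add_assoc])
    fun s' _ h => h
  rintro i s' hi hag hr h1
  refine Ends.straight (by trivial) (by simp [Prog.maxCost, RealExp.cost, NatExp.cost]; omega) ?_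
  have hag' : Agree [r] [A] s s' :=
    hag.mono (by simp [Prog.forReg, Prog.regs]) (by simp [Prog.forReg, Prog.arrays])
  simp [Prog.exec, RealExp.eval, NatExp.eval, hv i s' hi hag' hr, h1, Finset.sum_range_succ,
    add_assoc]

/-- Store the maximum of the values of `e` in cell `0` of array `A`. -/
def Prog.maximum (A : ℕ) (e : RealExp) : Prog :=
  .seq (.setReg 5 (.const 0)) <| .seq (.setMem A (.const 0) e) <|
    .forReg 5 2 (.ite (.realLt (.get A (.const 0)) e) (.setMem A (.const 0) e)
      (.setMem A (.const 0) (.get A (.const 0))))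

theorem Ends.maximum {A : ℕ} {e : RealExp} {s : State} {N T : ℕ} (v : ℕ → ℝ)
    (hN : s.reg 2 = N) (hN0 : 0 < N) (hT : N * (3 * e.cost + 20) + 20 ≤ T)
    (hv : ∀ i s', i < N → Agree [5] [A] s s' → s'.reg 5 = i → e.eval s' = v i) :
    Ends (.maximum A e) s T
      (fun s' => (∀ i < N, v i ≤ s'.mem A 0) ∧ ∃ i < N, s'.mem A 0 = v i) := by
  have hNe : e.cost ≤ N * e.cost := Nat.le_mul_of_pos_left _ hN0
  refine ((Ends.straight (T := 2) (Q := fun s' => s' = s.setR 5 0) (by trivial)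
    (by exact le_rfl) (by rfl)).seq
    (U := (e.cost + 2) + (N * (2 * e.cost + 20) + 6)) fun s₁ _ e₁ =>
    (Ends.straight (T := e.cost + 2) (Q := fun s' => Agree [5] [A] s s' ∧ s'.mem A 0 = v 0)
      (by trivial) (by simp [Prog.maxCost, NatExp.cost]; omega) ?_).seq fun s₂ _ e₂ =>
    (Ends.forReg (T := 2 * e.cost + 12)
    (fun i s' => (∀ j < i, v j ≤ s'.mem A 0) ∧ ∃ j < N, s'.mem A 0 = v j)
    ((e₂.1.reg 2 (by decide)).trans hN) (by decide)
    (by simp [Prog.regs]) (by simp [Prog.regs]) (by simpa using ⟨0, hN0, e₂.2⟩) ?_).mono le_rfl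
    fun s' _ h => h).mono (by ring_nf at *; omega) fun _ _ h => h
  · have hag : Agree [5] [A] s s₁ := e₁ ▸ (Agree.refl _ _ s).setR (by simp) 0
    have h1 : e.eval s₁ = v 0 := hv 0 s₁ hN0 hag (by simp [e₁])
    refine ⟨⟨fun r hr => hag.reg r hr, fun a ha => ?_⟩, ?_⟩
    · rw [← hag.mem a ha]
      exact Function.update_of_ne (by simpa using ha) _ _
    · simp [Prog.exec, NatExp.eval, h1]
  · rintro i s' hi hag hr ⟨h1, j, hj, h2⟩
    refine Ends.straight (by simp [Prog.LoopFree])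
      (by simp [Prog.maxCost, RealExp.cost, NatExp.cost, Test.cost]; omega) ?_
    have hag' : Agree [5] [A] s s' := e₂.1.trans
      (hag.mono (by simp [Prog.forReg, Prog.regs]) (by simp [Prog.forReg, Prog.arrays]))
    have he := hv i s' hi hag' hr
    by_cases hlt : s'.mem A 0 < v i
    · simp only [Prog.exec, Test.Holds, RealExp.eval, NatExp.eval, he, hlt, if_true,
        State.setR_mem, Function.update_self]
      refine ⟨fun l hl => ?_, i, hi, rfl⟩
      rcases (Nat.lt_succ_iff.1 hl).eq_or_lt with rfl | hl
      · exact le_rfl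
      · exact (h1 l hl).trans hlt.le
    · simp only [Prog.exec, Test.Holds, RealExp.eval, NatExp.eval, he, hlt, if_false,
        State.setR_mem, Function.update_self]
      refine ⟨fun l hl => ?_, j, hj, h2⟩
      rcases (Nat.lt_succ_iff.1 hl).eq_or_lt with rfl | hl
      · exact not_lt.1 hlt
      · exact h1 l hl

/-! ### Tensors in memory -/

/-- The tensor that is stored in an array. -/
def toTensor (n d : ℕ) (f : ℕ → ℝ) : Tensor n d := fun x => f (address x)

/-- `address` unfolds to the value of `finFunctionFinEquiv`, the expansion in base `n` with the
lowest digit first; the next facts are read off from this equivalence. -/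
theorem address_lt (x : Fin d → Fin n) : address x < n ^ d := (finFunctionFinEquiv x).2

theorem address_digit (x : Fin d → Fin n) (k : Fin d) : address x / n ^ (k : ℕ) % n = x k :=
  congrArg (fun y : Fin d → Fin n => (y k : ℕ)) (finFunctionFinEquiv.symm_apply_apply x)

theorem exists_address {a : ℕ} (ha : a < n ^ d) : ∃ x : Fin d → Fin n, address x = a :=
  ⟨finFunctionFinEquiv.symm ⟨a, ha⟩,
    congrArg Fin.val (finFunctionFinEquiv.apply_symm_apply (⟨a, ha⟩ : Fin (n ^ d)))⟩

theorem sum_range_pow (f : ℕ → ℝ) :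
    ∑ a ∈ Finset.range (n ^ d), f a = ∑ x : Fin d → Fin n, f (address x) := by
  rw [Finset.sum_range, ← Equiv.sum_comp finFunctionFinEquiv]
  rfl

/-- Compute the marginal, for the mode in register `3`, of the tensor in array `3`. -/
def Prog.computeMarginal : Prog :=
  .seq (.forReg 7 0 (.setMem 4 (.reg 7) (.ofNat (.const 0)))) <|
    .walk (.setMem 4 (.reg 7) (.add (.get 4 (.reg 7)) (.get 3 (.reg 5))))

theorem Ends.computeMarginal {s : State} (k : Fin d) (h0 : s.reg 0 = n) (h2 : s.reg 2 = n ^ d)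
    (h4 : s.reg 4 = n ^ (k : ℕ)) (hn : 0 < n) :
    Ends .computeMarginal s (70 * n ^ d)
      (fun s' => ∀ i : Fin n, s'.mem 4 i = marginal (toTensor n d (s.mem 3)) k i) := by
  have hd : d ≠ 0 := by have := k.2; omega
  have hnN : n ≤ n ^ d := Nat.le_self_pow hd n
  refine ((Ends.fill (T := n * 12 + 6) (A := 4) (fun _ => 0) h0 (by decide) (by trivial)
    (by rfl) (by simp [Prog.arrays]) le_rfl ?_).seq fun s₁ hag₁ h₁ =>
    -- After `a` addresses, cell `i` holds the sum of those entries seen so far whose digit for mode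
    -- `k` is `i`.
    (Ends.walk (T := 7) (n := n) (N := n ^ d) (w := n ^ (k : ℕ)) (fun a m => ∀ i < n, m 4 i =
      ∑ b ∈ Finset.range a, if b / n ^ (k : ℕ) % n = i then s.mem 3 b else 0) hn (by positivity)
      ((hag₁.reg 0 (by decide)).trans h0) ((hag₁.reg 2 (by decide)).trans h2)
      ((hag₁.reg 4 (by decide)).trans h4) (by trivial) (by exact le_rfl) (by rfl)
      (by simpa using h₁) ?_).mono le_rfl
      fun s' _ h i => ?_).mono (T' := 70 * n ^ d) (by omega) fun _ _ h => h
  · intro i s' _ _ hr _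
    simp [Prog.exec, NatExp.eval, RealExp.eval, hr]
  · intro a s' ha hag h5 h7 hI i hi
    have h3 : s'.mem 3 = s.mem 3 := (hag.mem 3 (by decide)).trans (hag₁.mem 3 (by decide))
    have h8 := hI (a / n ^ (k : ℕ) % n) (Nat.mod_lt _ hn)
    rw [Finset.sum_range_succ, ← hI i hi]
    simp only [Prog.exec, NatExp.eval, RealExp.eval, h5, h7, h3, Function.update_self]
    by_cases hc : a / n ^ (k : ℕ) % n = i
    · simp [hc]
    · rw [Function.update_of_ne (Ne.symm hc), if_neg hc, add_zero]
  · rw [h i i.2, sum_range_pow (n := n) (d := d), marginal, Finset.sum_filter]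
    simp [address_digit, Fin.val_inj, toTensor]

/-- Multiply the slices, for the mode in register `3`, of the tensor in array `S` by the entries of
array `5`. -/
def Prog.scale (S : ℕ) : Prog :=
  .walk (.setMem S (.reg 5) (.mul (.get S (.reg 5)) (.get 5 (.reg 7))))

/-- The array of multipliers must differ from the array being scaled, since it is read throughout
the traversal. -/
theorem Ends.scale {s : State} {S : ℕ} (hS : S ≠ 5) (k : Fin d) (h0 : s.reg 0 = n)
    (h2 : s.reg 2 = n ^ d) (h4 : s.reg 4 = n ^ (k : ℕ)) (hn : 0 < n) :
    Ends (.scale S) s (60 * n ^ d) (fun s' => toTensor n d (s'.mem S) =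
      scaleMode k (fun i => s.mem 5 i) (toTensor n d (s.mem S))) := by
  have hN : 0 < n ^ d := by positivity
  refine (Ends.walk (T := 7) (n := n) (N := n ^ d) (w := n ^ (k : ℕ)) (fun a m =>
    (∀ b < a, m S b = s.mem S b * s.mem 5 (b / n ^ (k : ℕ) % n)) ∧ ∀ b, a ≤ b → m S b = s.mem S b)
    hn (by positivity) h0 h2 h4 (by trivial) (by exact le_rfl) (by rfl) (by simp) ?_).mono
    (by omega) fun s' _ h => ?_
  · rintro a s' ha hag h5 h7 ⟨hI1, hI2⟩
    have e5 : s'.mem 5 = s.mem 5 := hag.mem 5 (by simp [Prog.arrays, hS.symm])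
    simp only [Prog.exec, NatExp.eval, RealExp.eval, h5, h7, e5, Function.update_self,
      hI2 a le_rfl]
    refine ⟨fun j hj => ?_, fun j hj => ?_⟩
    · rcases (Nat.lt_succ_iff.1 hj).eq_or_lt with rfl | hlt
      · simp
      · rw [Function.update_of_ne hlt.ne, hI1 j hlt]
    · rw [Function.update_of_ne (by omega), hI2 j (by omega)]
  · funext x
    rw [toTensor, h.1 _ (address_lt x), address_digit]
    rfl

/-! ### The algorithm -/

/-- The input is in memory, and register `2` holds the number of entries of a tensor. -/
structure Ready (s : State) (P : Fin d → Fin n → ℝ) (C : Tensor n d) (δ : ℝ) : Prop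
    extends IsInput s P C δ where
  size : s.reg 2 = n ^ d

theorem IsInput.of_agree {s s' : State} {P : Fin d → Fin n → ℝ} {C : Tensor n d} {δ : ℝ}
    (h : IsInput s P C δ) {R L : List ℕ} (hag : Agree R L s s') (hR : 0 ∉ R ∧ 1 ∉ R)
    (hL : 0 ∉ L ∧ 1 ∉ L ∧ 2 ∉ L) : IsInput s' P C δ where
  reg_zero := by rw [hag.reg 0 hR.1, h.reg_zero]
  reg_one := by rw [hag.reg 1 hR.2, h.reg_one]
  vectors := by rw [hag.mem 0 hL.1]; exact h.vectors
  cost := by rw [hag.mem 1 hL.2.1]; exact h.cost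
  tolerance := by rw [hag.mem 2 hL.2.2, h.tolerance]

theorem Ready.of_agree {s s' : State} {P : Fin d → Fin n → ℝ} {C : Tensor n d} {δ : ℝ}
    (h : Ready s P C δ) {R L : List ℕ} (hag : Agree R L s s') (hR : 0 ∉ R ∧ 1 ∉ R ∧ 2 ∉ R)
    (hL : 0 ∉ L ∧ 1 ∉ L ∧ 2 ∉ L) : Ready s' P C δ where
  toIsInput := h.toIsInput.of_agree hag ⟨hR.1, hR.2.1⟩ hL
  size := by rw [hag.reg 2 hR.2.2, h.size]

/-- Compute the number of entries of a tensor. -/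
def Prog.computeSize : Prog := .seq (.modes (.setReg 8 (.const 0))) (.setReg 2 (.reg 4))

/-- The loop over the modes is run with an irrelevant body, only for the power that it leaves in
register `4`. -/
theorem Ends.computeSize {s : State} {P : Fin d → Fin n → ℝ} {C : Tensor n d} {δ : ℝ}
    (h : IsInput s P C δ) : Ends .computeSize s (14 * d + 10) (fun s' => Ready s' P C δ) := by
  refine ((Ends.modes (T := 2) (fun _ _ _ => True) h.reg_zero h.reg_one (by decide) trivial
    fun k s' _ _ _ _ _ => Ends.straight (by trivial) (by exact le_rfl) (by trivial)).seq (U := 2)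
    fun s₁ _ e₁ => Ends.straight (Q := fun s' => s'.reg 2 = n ^ d) (by trivial) (by exact le_rfl)
      ?_).mono (by omega) fun s' hag e => ⟨h.of_agree hag (by decide) (by decide), e⟩
  simp [Prog.exec, NatExp.eval, e₁.1]

/-- Compute `max (spread C) δ`, the inverse temperature and the tolerance of the marginals. -/
def Prog.computeConstants : Prog :=
  .seq (.maximum 10 (.get 1 (.reg 5))) <|
  .seq (.maximum 11 (.sub (.ofNat (.const 0)) (.get 1 (.reg 5)))) <|
  .seq (.setMem 12 (.const 0) (.add (.get 10 (.const 0)) (.get 11 (.const 0)))) <|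
  .seq (.ite (.realLt (.get 12 (.const 0)) (.get 2 (.const 0)))
    (.setMem 12 (.const 0) (.get 2 (.const 0))) (.setReg 6 (.reg 6))) <|
  .seq (.setMem 13 (.const 0) (.div (.mul (.ofNat (.const 2)) (.mul (.ofNat (.reg 1))
    (.log (.add (.ofNat (.reg 0)) (.ofNat (.const 1)))))) (.get 2 (.const 0)))) <|
  .seq (.setMem 14 (.const 0) (.div (.get 2 (.const 0))
    (.mul (.ofNat (.const 4)) (.mul (.ofNat (.reg 1)) (.get 12 (.const 0))))))
  (.setMem 14 (.const 0) (.mul (.get 14 (.const 0)) (.get 14 (.const 0))))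

theorem spread_eq {C : Tensor n d} {x y : Fin d → Fin n} (hx : ∀ z, C z ≤ C x)
    (hy : ∀ z, C y ≤ C z) : spread C = C x - C y :=
  have : Nonempty (Fin d → Fin n) := ⟨x⟩
  le_antisymm (sub_le_sub (ciSup_le hx) (le_ciInf hy)) (sub_le_spread C x y)

theorem Ends.computeConstants {s : State} {P : Fin d → Fin n → ℝ} {C : Tensor n d} {δ : ℝ}
    (h : Ready s P C δ) (hn : 0 < n) :
    Ends .computeConstants s (300 * n ^ d) (fun s' => Ready s' P C δ ∧
      s'.mem 13 0 = 2 * (d * Real.log (n + 1)) / δ ∧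
      s'.mem 14 0 = (δ / (4 * (d * max (spread C) δ))) ^ 2) := by
  have hN : 0 < n ^ d := by positivity
  refine Ends.mono ((Ends.maximum (T := 46 * n ^ d) (fun i => s.mem 1 i) h.size hN
    (by simp [RealExp.cost, NatExp.cost]; omega) ?_).seq fun s₁ hag₁ e₁ =>
    (Ends.maximum (T := 55 * n ^ d) (fun i => 0 - s.mem 1 i)
      ((hag₁.reg 2 (by decide)).trans h.size) hN
      (by simp [RealExp.cost, NatExp.cost]; omega) ?_).seq (U := 100)
      (Q := fun s' => s'.mem 13 0 = 2 * (d * Real.log (n + 1)) / δ ∧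
        s'.mem 14 0 = (δ / (4 * (d * max (spread C) δ))) ^ 2) fun s₂ hag₂ e₂ =>
      Ends.straight (by simp [Prog.LoopFree]) (by decide) ?_)
    (by omega) fun s' hag e => ⟨h.of_agree hag (by decide) (by decide), e⟩
  · intro i s' _ hag hr
    simp [RealExp.eval, NatExp.eval, hr, hag.mem 1 (by decide)]
  · intro i s' _ hag hr
    simp [RealExp.eval, NatExp.eval, hr, hag.mem 1 (by decide), hag₁.mem 1 (by decide)]
  · have h' : Ready s₂ P C δ :=
      (h.of_agree hag₁ (by decide) (by decide)).of_agree hag₂ (by decide) (by decide)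
    -- The spread is the maximum of `C` plus the maximum of its negative.
    have hsp : s₂.mem 10 0 + s₂.mem 11 0 = spread C := by
      obtain ⟨h1, a, ha, h2⟩ := e₁
      obtain ⟨h3, b, hb, h4⟩ := e₂
      obtain ⟨x, rfl⟩ := exists_address ha
      obtain ⟨y, rfl⟩ := exists_address hb
      rw [h2, h.cost] at h1
      rw [h4, h.cost] at h3
      have hx : ∀ z, C z ≤ C x := fun z => by
        have := h1 _ (address_lt z)
        rwa [h.cost] at this
      have hy : ∀ z, C y ≤ C z := fun z => by
        have := h3 _ (address_lt z)
        rw [h.cost] at this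
        linarith
      rw [hag₂.mem 10 (by decide), h2, h4, h.cost, h.cost, spread_eq hx hy]
      ring
    by_cases hlt : spread C < δ
    · simp [Prog.exec, Test.Holds, RealExp.eval, NatExp.eval, hsp, hlt, hlt.le, h'.reg_zero,
        h'.reg_one, h'.tolerance, sq]
    · simp [Prog.exec, Test.Holds, RealExp.eval, NatExp.eval, hsp, hlt, not_lt.1 hlt, h'.reg_zero,
        h'.reg_one, h'.tolerance, sq]

/-- Store the Gibbs tensor in array `3`. -/
def Prog.start : Prog :=
  .seq (.forReg 5 2 (.setMem 3 (.reg 5)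
    (.exp (.sub (.ofNat (.const 0)) (.mul (.get 13 (.const 0)) (.get 1 (.reg 5))))))) <|
  .seq (.setMem 15 (.const 0) (.ofNat (.const 0))) <|
  .seq (.accum 5 2 15 (.get 3 (.reg 5))) <|
  .forReg 5 2 (.setMem 3 (.reg 5) (.div (.get 3 (.reg 5)) (.get 15 (.const 0))))

theorem Ends.start {s : State} {P : Fin d → Fin n → ℝ} {C : Tensor n d} {δ : ℝ}
    (h : Ready s P C δ) (hn : 0 < n) : Ends .start s (100 * n ^ d)
      (fun s' => toTensor n d (s'.mem 3) = gibbsStart (s.mem 13 0) C) := by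
  have hN : 0 < n ^ d := by positivity
  let v : ℕ → ℝ := fun i => Real.exp (0 - s.mem 13 0 * s.mem 1 i)
  refine Ends.mono ((Ends.fill (T := 25 * n ^ d) (A := 3) v h.size (by decide) (by trivial)
    (by rfl) (by decide) (by simp [Prog.maxCost, RealExp.cost, NatExp.cost]; omega) ?_).seq
    fun s₁ hag₁ e₁ => (Ends.straight (T := 5) (Q := fun s' => s'.mem 15 0 = 0) (by trivial)
      (by decide) ?_).seq fun s₂ hag₂ e₂ =>
    (Ends.accum (T := 25 * n ^ d) v (N := n ^ d) ?_ (by decide)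
      (by simp [RealExp.cost, NatExp.cost]; omega) ?_).seq fun s₃ hag₃ e₃ =>
    (Ends.fill (T := 25 * n ^ d) (A := 3)
      (fun i => v i / ∑ j ∈ Finset.range (n ^ d), v j) (N := n ^ d) ?_ (by decide) (by trivial)
      (by rfl) (by decide) (by simp [Prog.maxCost, RealExp.cost, NatExp.cost]; omega) ?_))
    (by omega) fun s' hag e => ?_
  · intro i s' _ hag hr _
    simp [Prog.exec, NatExp.eval, RealExp.eval, hr, hag.mem 13 (by decide), hag.mem 1 (by decide),
      v]
  · simp [Prog.exec, NatExp.eval, RealExp.eval]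
  · rw [hag₂.reg 2 (by decide), hag₁.reg 2 (by decide), h.size]
  · intro i s' hi hag hr
    simp [NatExp.eval, RealExp.eval, hr, hag.mem 3 (by decide), hag₂.mem 3 (by decide), e₁ i hi]
  · rw [hag₃.reg 2 (by decide), hag₂.reg 2 (by decide), hag₁.reg 2 (by decide), h.size]
  · intro i s' hi hag hr h3
    have h3' : s'.mem 3 i = v i := by
      rw [h3, hag₃.mem 3 (by decide), hag₂.mem 3 (by decide), e₁ i hi]
    simp [Prog.exec, NatExp.eval, RealExp.eval, hr, h3', hag.mem 15 (by decide), e₃, e₂]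
  · funext x
    rw [toTensor, e _ (address_lt x), sum_range_pow (n := n) (d := d)]
    simp only [v, h.cost]
    rfl

/-- The address of an entry of the current vector. -/
def NatExp.vectorEntry : NatExp := .add (.mul (.reg 3) (.reg 0)) (.reg 7)

/-- Scale the slices of the current mode if its marginal is not close to the one prescribed. -/
def Prog.sinkhornMode : Prog :=
  .seq .computeMarginal <|
  .seq (.forReg 7 0 (.setMem 5 (.reg 7) (.div (.get 0 .vectorEntry) (.get 4 (.reg 7))))) <|
  .seq (.setMem 16 (.const 0) (.ofNat (.const 0))) <|
  .seq (.accum 7 0 16 (.mul (.get 0 .vectorEntry) (.log (.get 5 (.reg 7))))) <|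
  .ite (.realLt (.get 14 (.const 0)) (.get 16 (.const 0)))
    (.seq (.setReg 8 (.const 1)) (.scale 3)) (.setReg 6 (.reg 6))

theorem Ends.sinkhornMode {s : State} {P : Fin d → Fin n → ℝ} {C : Tensor n d} {δ : ℝ}
    (h : Ready s P C δ) (hn : 0 < n) (k : Fin d) (h3 : s.reg 3 = k)
    (h4 : s.reg 4 = n ^ (k : ℕ)) {A : Tensor n d} (hA : toTensor n d (s.mem 3) = A) :
    Ends .sinkhornMode s (300 * n ^ d) (fun s' =>
      (relEntropy (P k) (marginal A k) ≤ s.mem 14 0 ∧ toTensor n d (s'.mem 3) = A ∧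
        s'.reg 8 = s.reg 8) ∨
      (s.mem 14 0 < relEntropy (P k) (marginal A k) ∧
        toTensor n d (s'.mem 3) = matchMode P k A ∧ s'.reg 8 = 1)) := by
  have hN : 0 < n ^ d := by positivity
  have hnN : n ≤ n ^ d := Nat.le_self_pow (by have := k.2; omega) n
  let v : ℕ → ℝ := fun i => if hi : i < n then P k ⟨i, hi⟩ / marginal A k ⟨i, hi⟩ else 0
  let w : ℕ → ℝ := fun i => if hi : i < n then
    P k ⟨i, hi⟩ * Real.log (P k ⟨i, hi⟩ / marginal A k ⟨i, hi⟩) else 0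
  refine Ends.mono ((Ends.computeMarginal k h.reg_zero h.size h4 hn).seq fun s₁ hag₁ e₁ =>
    (Ends.fill (T := 35 * n ^ d) (A := 5) v (N := n) ?_ (by decide) (by trivial) (by rfl)
      (by decide) (by simp [Prog.maxCost, RealExp.cost, NatExp.cost, NatExp.vectorEntry]; omega)
      ?_).seq fun s₂ hag₂ e₂ =>
    (Ends.straight (T := 5) (Q := fun s' => s'.mem 16 0 = 0) (by trivial) (by decide) ?_).seq
    fun s₃ hag₃ e₃ =>
    (Ends.accum (T := 35 * n ^ d) w (N := n) ?_ (by decide)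
      (by simp [RealExp.cost, NatExp.cost, NatExp.vectorEntry]; omega) ?_).seq fun s₄ hag₄ e₄ =>
    (Ends.ite (T := 2 + 60 * n ^ d) ?_ ?_).mono (T' := 70 * n ^ d)
      (by simp [Test.cost, RealExp.cost, NatExp.cost]; omega) fun _ _ h => h)
    (by omega) fun s' hag e => e
  · rw [hag₁.reg 0 (by decide), h.reg_zero]
  · intro i s' hi hag hr _
    have e1 : s'.mem 0 (k * n + i) = P k ⟨i, hi⟩ := by
      rw [hag.mem 0 (by decide), hag₁.mem 0 (by decide)]
      exact h.vectors k ⟨i, hi⟩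
    have e2 : s'.mem 4 i = marginal A k ⟨i, hi⟩ := by
      rw [hag.mem 4 (by decide), ← hA]
      exact e₁ ⟨i, hi⟩
    simp [Prog.exec, NatExp.eval, RealExp.eval, NatExp.vectorEntry, hr, hag.reg 3 (by decide),
      hag₁.reg 3 (by decide), h3, hag.reg 0 (by decide), hag₁.reg 0 (by decide), h.reg_zero, e1,
      e2, v, hi]
  · simp [Prog.exec, NatExp.eval, RealExp.eval]
  · rw [hag₃.reg 0 (by decide), hag₂.reg 0 (by decide), hag₁.reg 0 (by decide), h.reg_zero]
  · intro i s' hi hag hr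
    have e1 : s'.mem 0 (k * n + i) = P k ⟨i, hi⟩ := by
      rw [hag.mem 0 (by decide), hag₃.mem 0 (by decide), hag₂.mem 0 (by decide),
        hag₁.mem 0 (by decide)]
      exact h.vectors k ⟨i, hi⟩
    have e2 : s'.mem 5 i = v i := by
      rw [hag.mem 5 (by decide), hag₃.mem 5 (by decide), e₂ i hi]
    have e5 : s'.reg 3 = k := by
      rw [hag.reg 3 (by decide), hag₃.reg 3 (by decide), hag₂.reg 3 (by decide),
        hag₁.reg 3 (by decide), h3]
    have e6 : s'.reg 0 = n := by
      rw [hag.reg 0 (by decide), hag₃.reg 0 (by decide), hag₂.reg 0 (by decide),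
        hag₁.reg 0 (by decide), h.reg_zero]
    simp [NatExp.eval, RealExp.eval, NatExp.vectorEntry, hr, e5, e6, e1, e2, v, w, hi]
  -- Both branches start from the same facts: the threshold is intact and cell `0` of array `16`
  -- holds the relative entropy.
  all_goals
    have hag' := ((hag₁.mono (R' := [5, 6, 7]) (L' := [4, 5, 16]) (by decide) (by decide)).trans
      (hag₂.mono (by decide) (by decide))).trans
      ((hag₃.mono (by decide) (by decide)).trans (hag₄.mono (by decide) (by decide)))
    have e14 : s₄.mem 14 = s.mem 14 := hag'.mem 14 (by decide)
    have e16 : s₄.mem 16 0 = relEntropy (P k) (marginal A k) := by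
      rw [e₄, e₃, zero_add, Finset.sum_range, relEntropy]
      simp [w]
    simp only [Test.Holds, RealExp.eval, NatExp.eval, e14, e16]
  · intro hlt
    refine (Ends.straight (T := 2) (Q := fun s' => s' = s₄.setR 8 1) (by trivial) (by decide)
      (by rfl)).seq fun s₅ hag₅ e₅ => (Ends.scale (by decide) k ?_ ?_ ?_ hn).mono le_rfl
        fun s' hag e => Or.inr ⟨hlt, ?_, ?_⟩
    · rw [hag₅.reg 0 (by decide), hag'.reg 0 (by decide), h.reg_zero]
    · rw [hag₅.reg 2 (by decide), hag'.reg 2 (by decide), h.size]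
    · rw [hag₅.reg 4 (by decide), hag'.reg 4 (by decide), h4]
    · rw [e, hag₅.mem 3 (by decide), hag'.mem 3 (by decide), hA, matchMode]
      congr 1
      funext i
      rw [hag₅.mem 5 (by decide), hag₄.mem 5 (by decide), hag₃.mem 5 (by decide), e₂ i i.2]
      simp [v]
    · rw [hag.reg 8 (by decide), e₅]
      simp
  · intro hle
    refine Ends.straight (by trivial) (by simp [Prog.maxCost, NatExp.cost])
      (Or.inl ⟨not_lt.1 hle, ?_, ?_⟩)
    · simp [Prog.exec, hag'.mem 3 (by decide), hA]
    · simp [Prog.exec, hag'.reg 8 (by decide)]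

/-- Scale slices until all marginals are close to those prescribed. -/
def Prog.sinkhorn : Prog :=
  .seq (.setReg 8 (.const 1)) <| .loop (.natLt (.const 0) (.reg 8)) <|
    .seq (.setReg 8 (.const 0)) (.modes .sinkhornMode)

/-- If the flag is still zero, no mode was scaled, so all tests of the pass concerned the same
tensor `A` and hold for it simultaneously. Otherwise the first scaling pays for the drop of the
potential, and further ones only lower it, as the threshold is nonnegative. -/
theorem Ends.sinkhornPass {s : State} {P : Fin d → Fin n → ℝ} {C : Tensor n d} {δ : ℝ}
    (h : Ready s P C δ) (hP : ∀ k, IsPosProbVec (P k)) (hn : 0 < n) (hd : 0 < d) {η : ℝ}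
    (hκ : 0 ≤ s.mem 14 0) {A : Tensor n d} (hA : toTensor n d (s.mem 3) = A)
    (hG : IsGibbs η C A) :
    Ends (.seq (.setReg 8 (.const 0)) (.modes .sinkhornMode)) s (322 * (d * n ^ d)) (fun s' =>
      (s'.reg 8 = 0 ∧ toTensor n d (s'.mem 3) = A ∧
        ∀ k, relEntropy (P k) (marginal A k) ≤ s.mem 14 0) ∨
      (s'.reg 8 = 1 ∧ IsGibbs η C (toTensor n d (s'.mem 3)) ∧
        potential P (toTensor n d (s'.mem 3)) + s.mem 14 0 ≤ potential P A)) := by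
  have hN : 0 < n ^ d := by positivity
  have hdN : d ≤ d * n ^ d := Nat.le_mul_of_pos_right _ hN
  let I : ℕ → ℕ → (ℕ → ℕ → ℝ) → Prop := fun k f m =>
    (f = 0 ∧ toTensor n d (m 3) = A ∧
      ∀ j : Fin d, (j : ℕ) < k → relEntropy (P j) (marginal A j) ≤ s.mem 14 0) ∨
    (f = 1 ∧ IsGibbs η C (toTensor n d (m 3)) ∧
      potential P (toTensor n d (m 3)) + s.mem 14 0 ≤ potential P A)
  refine Ends.mono ((Ends.straight (T := 2) (Q := fun s' => s' = s.setR 8 0) (by trivial)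
    (by decide) (by rfl)).seq fun s₁ hag₁ e₁ =>
    Ends.modes (T := 300 * n ^ d) (n := n) (d := d) I ?_ ?_ (by decide) ?_ ?_) ?_ ?_
  · rw [hag₁.reg 0 (by decide), h.reg_zero]
  · rw [hag₁.reg 1 (by decide), h.reg_one]
  · exact Or.inl ⟨by simp [e₁], by simp [e₁, hA], by simp⟩
  · intro k s' hk hag hr3 hr4 hI
    have h' : Ready s' P C δ :=
      (h.of_agree hag₁ (by decide) (by decide)).of_agree hag (by decide) (by decide)
    have e14 : s'.mem 14 = s.mem 14 := by rw [hag.mem 14 (by decide), hag₁.mem 14 (by decide)]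
    refine (Ends.sinkhornMode h' hn ⟨k, hk⟩ hr3 hr4 rfl).mono le_rfl fun s'' _ e => ?_
    rw [e14] at e
    rcases hI with ⟨hf, hT, hrel⟩ | ⟨hf, hG', hpot⟩
    · rw [hT] at e
      rcases e with ⟨e1, e2, e3⟩ | ⟨e1, e2, e3⟩
      · refine Or.inl ⟨e3.trans hf, e2, fun j hj => ?_⟩
        rcases (Nat.lt_succ_iff.1 hj).eq_or_lt with hjk | hlt
        · have : j = ⟨k, hk⟩ := Fin.ext hjk
          exact this ▸ e1
        · exact hrel j hlt
      · refine Or.inr ⟨e3, e2 ▸ hG.matchMode hP _, ?_⟩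
        rw [e2, hG.potential_matchMode hP]
        linarith
    · rcases e with ⟨e1, e2, e3⟩ | ⟨e1, e2, e3⟩
      · exact Or.inr ⟨e3.trans hf, e2 ▸ hG', by rw [e2]; exact hpot⟩
      · refine Or.inr ⟨e3, e2 ▸ hG'.matchMode hP _, ?_⟩
        rw [e2, hG'.potential_matchMode hP]
        linarith
  · have : d * (300 * n ^ d + 12) = 300 * (d * n ^ d) + 12 * d := by ring
    have := Nat.mul_pos hd hN
    omega
  · rintro s' - ⟨-, hI | hI⟩
    · exact Or.inl ⟨hI.1, hI.2.1, fun k => hI.2.2 k k.2⟩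
    · exact Or.inr hI

/-- Every pass but the last uses up one threshold of potential, so at most `m + 1` passes occur; the
remaining unit covers the overhead. -/
theorem Ends.sinkhorn {s : State} {P : Fin d → Fin n → ℝ} {C : Tensor n d} {δ : ℝ}
    (h : Ready s P C δ) (hP : ∀ k, IsPosProbVec (P k)) (hn : 0 < n) (hd : 0 < d) {η : ℝ}
    (hκ : 0 < s.mem 14 0) (hG : IsGibbs η C (toTensor n d (s.mem 3))) (m : ℕ)
    (hm : potential P (toTensor n d (s.mem 3)) ≤ m * s.mem 14 0) :
    Ends .sinkhorn s ((m + 2) * (330 * (d * n ^ d))) (fun s' => Ready s' P C δ ∧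
      IsGibbs η C (toTensor n d (s'.mem 3)) ∧
        ∀ k, relEntropy (P k) (marginal (toTensor n d (s'.mem 3)) k) ≤ s.mem 14 0) := by
  have hdN : 0 < d * n ^ d := by positivity
  -- The rank bounds the passes still to come, including the final one that changes nothing; hence
  -- `m - 1` thresholds of potential.
  let J : ℕ → State → Prop := fun m s' => Ready s' P C δ ∧ s'.mem 14 = s.mem 14 ∧
    IsGibbs η C (toTensor n d (s'.mem 3)) ∧
    ((s'.reg 8 = 0 ∧
      ∀ k, relEntropy (P k) (marginal (toTensor n d (s'.mem 3)) k) ≤ s.mem 14 0) ∨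
    (s'.reg 8 = 1 ∧ 0 < m ∧ potential P (toTensor n d (s'.mem 3)) ≤ (m - 1) * s.mem 14 0))
  refine Ends.mono ((Ends.straight (T := 2) (Q := fun s' => s' = s.setR 8 1) (by trivial)
    (by decide) (by rfl)).seq fun s₁ hag₁ e₁ =>
    Ends.loop (T := 322 * (d * n ^ d)) J ?_ (m + 1) s₁ ?_) ?_ ?_
  · rintro m s' ⟨hr, h14, hG', hc⟩ hb
    simp only [Test.Holds, NatExp.eval] at hb
    rcases hc with hc | ⟨-, hm0, hpot⟩
    · omega
    · refine (Ends.sinkhornPass hr hP hn hd (by rw [h14]; exact hκ.le) rfl hG').mono le_rfl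
        fun s'' hag e => ?_
      have hr' := hr.of_agree hag (by decide) (by decide)
      have h14' : s''.mem 14 = s.mem 14 := by rw [hag.mem 14 (by decide), h14]
      refine ⟨m - 1, by omega, hr', h14', ?_⟩
      rw [h14] at e
      rcases e with ⟨e1, e2, e3⟩ | ⟨e1, e2, e3⟩
      · rw [e2]
        exact ⟨hG', Or.inl ⟨e1, e3⟩⟩
      -- The potential remains nonnegative after the drop, so more than one unit of rank was
      -- available and the new rank is still positive.
      · have hnn := e2.potential_nonneg hP
        have hm1 : (1 : ℝ) < m := by
          by_contra hle
          have := mul_nonneg (sub_nonneg.2 (not_lt.1 hle)) hκ.le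
          nlinarith
        have hm2 : 1 < m := by exact_mod_cast hm1
        refine ⟨e2, Or.inr ⟨e1, by omega, ?_⟩⟩
        push_cast [hm2.le]
        linarith
  · refine ⟨h.of_agree hag₁ (by decide) (by decide), hag₁.mem 14 (by decide), ?_, ?_⟩
    · rw [e₁]; exact hG
    · rw [e₁]
      exact Or.inr ⟨by simp, by omega, by simpa using hm⟩
  · simp only [Test.cost, NatExp.cost]
    have h1 : (m + 1) * (1 + 1 + 1 + 1 + 322 * (d * n ^ d)) ≤ (m + 1) * (330 * (d * n ^ d)) :=
      Nat.mul_le_mul_left _ (by omega)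
    have h2 : (m + 2) * (330 * (d * n ^ d)) = (m + 1) * (330 * (d * n ^ d)) + 330 * (d * n ^ d) := by
      ring
    omega
  · rintro s' - ⟨hb, m', hr, h14, hG', hc⟩
    simp only [Test.Holds, NatExp.eval] at hb
    rcases hc with hc | hc
    · exact ⟨hr, hG', hc.2⟩
    · omega

/-- Shrink the slices of the current mode so that its marginal does not exceed that prescribed. -/
def Prog.shrinkMode : Prog :=
  .seq .computeMarginal <|
  .seq (.forReg 7 0 <|
    .seq (.setMem 5 (.reg 7) (.div (.get 0 .vectorEntry) (.get 4 (.reg 7)))) <|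
    .ite (.realLt (.ofNat (.const 1)) (.get 5 (.reg 7)))
      (.setMem 5 (.reg 7) (.ofNat (.const 1))) (.setMem 5 (.reg 7) (.get 5 (.reg 7)))) <|
  .scale 3

theorem Ends.shrinkMode {s : State} {P : Fin d → Fin n → ℝ} {C : Tensor n d} {δ : ℝ}
    (h : Ready s P C δ) (hn : 0 < n) (k : Fin d) (h3 : s.reg 3 = k)
    (h4 : s.reg 4 = n ^ (k : ℕ)) {A : Tensor n d} (hA : toTensor n d (s.mem 3) = A) :
    Ends .shrinkMode s (200 * n ^ d) (fun s' => toTensor n d (s'.mem 3) =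
      scaleMode k (fun i => min 1 (P k i / marginal A k i)) A) := by
  have hN : 0 < n ^ d := by positivity
  have hnN : n ≤ n ^ d := Nat.le_self_pow (by have := k.2; omega) n
  let v : ℕ → ℝ := fun i => if hi : i < n then min 1 (P k ⟨i, hi⟩ / marginal A k ⟨i, hi⟩) else 0
  refine Ends.mono_time ((Ends.computeMarginal k h.reg_zero h.size h4 hn).seq fun s₁ hag₁ e₁ =>
    (Ends.fill (T := 60 * n ^ d) (A := 5) v (N := n) ?_ (by decide) (by simp [Prog.LoopFree])
      (by rfl) (by decide)
      (by simp [Prog.maxCost, RealExp.cost, NatExp.cost, NatExp.vectorEntry, Test.cost]; omega)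
      ?_).seq fun s₂ hag₂ e₂ => (Ends.scale (by decide) k ?_ ?_ ?_ hn).mono
      le_rfl fun s' _ e => ?_) (by omega)
  · rw [hag₁.reg 0 (by decide), h.reg_zero]
  · intro i s' hi hag hr _
    have e1 : s'.mem 0 (k * n + i) = P k ⟨i, hi⟩ := by
      rw [hag.mem 0 (by decide), hag₁.mem 0 (by decide)]
      exact h.vectors k ⟨i, hi⟩
    have e2 : s'.mem 4 i = marginal A k ⟨i, hi⟩ := by
      rw [hag.mem 4 (by decide), ← hA]
      exact e₁ ⟨i, hi⟩
    have e3 : s'.reg 3 = k := by rw [hag.reg 3 (by decide), hag₁.reg 3 (by decide), h3]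
    have e4 : s'.reg 0 = n := by rw [hag.reg 0 (by decide), hag₁.reg 0 (by decide), h.reg_zero]
    by_cases hlt : 1 < P k ⟨i, hi⟩ / marginal A k ⟨i, hi⟩
    · simp [Prog.exec, NatExp.eval, RealExp.eval, NatExp.vectorEntry, Test.Holds, hr, e1, e2, e3,
        e4, v, hi, hlt, hlt.le]
    · simp [Prog.exec, NatExp.eval, RealExp.eval, NatExp.vectorEntry, Test.Holds, hr, e1, e2, e3,
        e4, v, hi, hlt, not_lt.1 hlt]
  · rw [hag₂.reg 0 (by decide), hag₁.reg 0 (by decide), h.reg_zero]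
  · rw [hag₂.reg 2 (by decide), hag₁.reg 2 (by decide), h.size]
  · rw [hag₂.reg 4 (by decide), hag₁.reg 4 (by decide), h4]
  · rw [e, hag₂.mem 3 (by decide), hag₁.mem 3 (by decide), hA]
    congr 1
    funext i
    rw [e₂ i i.2]
    simp [v]

theorem Ends.shrink {s : State} {P : Fin d → Fin n → ℝ} {C : Tensor n d} {δ : ℝ}
    (h : Ready s P C δ) (hn : 0 < n) (hd : 0 < d) {A : Tensor n d}
    (hA : toTensor n d (s.mem 3) = A) :
    Ends (.modes .shrinkMode) s (220 * (d * n ^ d)) (fun s' => Ready s' P C δ ∧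
      toTensor n d (s'.mem 3) = shrink P A d) := by
  have hN : 0 < n ^ d := by positivity
  have hdN : d ≤ d * n ^ d := Nat.le_mul_of_pos_right _ hN
  refine Ends.mono (Ends.modes (T := 200 * n ^ d) (n := n) (d := d)
    (fun k _ m => toTensor n d (m 3) = TOT.shrink P A k) h.reg_zero h.reg_one (by decide) hA ?_)
    ?_ fun s' hag e => ⟨h.of_agree hag (by decide) (by decide), e.2⟩
  · intro k s' hk hag hr3 hr4 hI
    refine (Ends.shrinkMode (h.of_agree hag (by decide) (by decide)) hn ⟨k, hk⟩ hr3 hr4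
      hI).mono le_rfl fun s'' _ e => ?_
    rw [e, TOT.shrink, dif_pos hk]
  · have : d * (200 * n ^ d + 12) = 200 * (d * n ^ d) + 12 * d := by ring
    omega

/-- Multiply the slices of the tensor in array `7` by the normalized defect of the marginal. -/
def Prog.defectMode : Prog :=
  .seq .computeMarginal <|
  .seq (.forReg 7 0 <| .setMem 5 (.reg 7)
    (.div (.sub (.get 0 .vectorEntry) (.get 4 (.reg 7))) (.get 17 (.const 0)))) <|
  .scale 7

theorem Ends.defectMode {s : State} {P : Fin d → Fin n → ℝ} {C : Tensor n d} {δ : ℝ}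
    (h : Ready s P C δ) (hn : 0 < n) (k : Fin d) (h3 : s.reg 3 = k)
    (h4 : s.reg 4 = n ^ (k : ℕ)) {A : Tensor n d} (hA : toTensor n d (s.mem 3) = A) :
    Ends .defectMode s (200 * n ^ d) (fun s' => toTensor n d (s'.mem 7) =
      scaleMode k (fun i => (P k i - marginal A k i) / s.mem 17 0) (toTensor n d (s.mem 7))) := by
  have hN : 0 < n ^ d := by positivity
  have hnN : n ≤ n ^ d := Nat.le_self_pow (by have := k.2; omega) n
  let v : ℕ → ℝ := fun i => if hi : i < n then
    (P k ⟨i, hi⟩ - marginal A k ⟨i, hi⟩) / s.mem 17 0 else 0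
  refine Ends.mono_time ((Ends.computeMarginal k h.reg_zero h.size h4 hn).seq fun s₁ hag₁ e₁ =>
    (Ends.fill (T := 60 * n ^ d) (A := 5) v (N := n) ?_ (by decide) (by trivial) (by rfl)
      (by decide) (by simp [Prog.maxCost, RealExp.cost, NatExp.cost, NatExp.vectorEntry]; omega)
      ?_).seq fun s₂ hag₂ e₂ => (Ends.scale (by decide) k ?_ ?_ ?_ hn).mono
      le_rfl fun s' _ e => ?_) (by omega)
  · rw [hag₁.reg 0 (by decide), h.reg_zero]
  · intro i s' hi hag hr _
    have e1 : s'.mem 0 (k * n + i) = P k ⟨i, hi⟩ := by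
      rw [hag.mem 0 (by decide), hag₁.mem 0 (by decide)]
      exact h.vectors k ⟨i, hi⟩
    have e2 : s'.mem 4 i = marginal A k ⟨i, hi⟩ := by
      rw [hag.mem 4 (by decide), ← hA]
      exact e₁ ⟨i, hi⟩
    have e3 : s'.reg 3 = k := by rw [hag.reg 3 (by decide), hag₁.reg 3 (by decide), h3]
    have e4 : s'.reg 0 = n := by rw [hag.reg 0 (by decide), hag₁.reg 0 (by decide), h.reg_zero]
    have e5 : s'.mem 17 = s.mem 17 := by rw [hag.mem 17 (by decide), hag₁.mem 17 (by decide)]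
    simp [Prog.exec, NatExp.eval, RealExp.eval, NatExp.vectorEntry, hr, e1, e2, e3, e4, e5, v, hi]
  · rw [hag₂.reg 0 (by decide), hag₁.reg 0 (by decide), h.reg_zero]
  · rw [hag₂.reg 2 (by decide), hag₁.reg 2 (by decide), h.size]
  · rw [hag₂.reg 4 (by decide), hag₁.reg 4 (by decide), h4]
  · rw [e, hag₂.mem 7 (by decide), hag₁.mem 7 (by decide)]
    congr 1
    funext i
    rw [e₂ i i.2]
    simp [v]

/-- Correct the marginals by a rank-one tensor. -/
def Prog.complete : Prog :=
  .seq (.setMem 17 (.const 0) (.ofNat (.const 1))) <|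
  .seq (.accum 5 2 17 (.sub (.ofNat (.const 0)) (.get 3 (.reg 5)))) <|
  .seq (.forReg 5 2 (.setMem 7 (.reg 5) (.ofNat (.const 1)))) <|
  .seq (.modes .defectMode) <|
  .forReg 5 2 (.setMem 3 (.reg 5)
    (.add (.get 3 (.reg 5)) (.mul (.get 17 (.const 0)) (.get 7 (.reg 5)))))

/-- The rank-one tensor is built mode by mode in array `7`. Array `3` keeps `A` until the last loop,
so every defect is computed from the marginals of `A` itself. -/
theorem Ends.complete {s : State} {P : Fin d → Fin n → ℝ} {C : Tensor n d} {δ : ℝ}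
    (h : Ready s P C δ) (hn : 0 < n) (hd : 0 < d) {A : Tensor n d}
    (hA : toTensor n d (s.mem 3) = A) :
    Ends .complete s (400 * (d * n ^ d))
      (fun s' => toTensor n d (s'.mem 3) = complete P A) := by
  have hN : 0 < n ^ d := by positivity
  have hdN : d ≤ d * n ^ d := Nat.le_mul_of_pos_right _ hN
  have hdN' : n ^ d ≤ d * n ^ d := Nat.le_mul_of_pos_left _ hd
  let f : Fin d → Fin n → ℝ := fun k i => (P k i - marginal A k i) / (1 - ∑ y, A y)
  -- The product runs over natural numbers so that the next mode is split off by
  -- `Finset.prod_range_succ`; the default factor one never occurs for `k ≤ d`.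
  let I : ℕ → ℕ → (ℕ → ℕ → ℝ) → Prop := fun k _ m => toTensor n d (m 7) =
    fun x => ∏ j ∈ Finset.range k, if hj : j < d then f ⟨j, hj⟩ (x ⟨j, hj⟩) else 1
  refine Ends.mono_time ((Ends.straight (T := 5) (Q := fun s' => s'.mem 17 0 = 1) (by trivial)
    (by decide) ?_).seq fun s₁ hag₁ e₁ =>
    (Ends.accum (T := 25 * n ^ d) (fun i => 0 - s.mem 3 i) (N := n ^ d) ?_ (by decide)
      (by simp [RealExp.cost, NatExp.cost]; omega) ?_).seq fun s₂ hag₂ e₂ =>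
    (Ends.fill (T := 25 * n ^ d) (A := 7) (fun _ => 1) (N := n ^ d) ?_ (by decide) (by trivial)
      (by rfl) (by decide) (by simp [Prog.maxCost, RealExp.cost, NatExp.cost]; omega)
      ?_).seq fun s₃ hag₃ e₃ =>
    (Ends.modes (T := 200 * n ^ d) (n := n) (d := d) I ?_ ?_ (by decide) ?_ ?_).seq
      fun s₄ hag₄ e₄ =>
    (Ends.fill (T := 35 * n ^ d) (A := 3) (fun i => s.mem 3 i + (1 - ∑ y, A y) * s₄.mem 7 i)
      (N := n ^ d) ?_ (by decide) (by trivial) (by rfl) (by decide)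
      (by simp [Prog.maxCost, RealExp.cost, NatExp.cost]; omega) ?_).mono le_rfl
      fun s' hag e => ?_)
    ?_
  · simp [Prog.exec, NatExp.eval, RealExp.eval]
  · rw [hag₁.reg 2 (by decide), h.size]
  · intro i s' hi hag hr
    simp [NatExp.eval, RealExp.eval, hr, hag.mem 3 (by decide), hag₁.mem 3 (by decide)]
  · rw [hag₂.reg 2 (by decide), hag₁.reg 2 (by decide), h.size]
  · intro i s' hi hag hr _
    simp [Prog.exec, NatExp.eval, RealExp.eval, hr]
  · rw [hag₃.reg 0 (by decide), hag₂.reg 0 (by decide), hag₁.reg 0 (by decide), h.reg_zero]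
  · rw [hag₃.reg 1 (by decide), hag₂.reg 1 (by decide), hag₁.reg 1 (by decide), h.reg_one]
  · funext x
    simpa [toTensor] using e₃ _ (address_lt x)
  · intro k s' hk hag hr3 hr4 hI
    have hag' := ((hag₁.mono (R' := [3, 4, 5, 6, 7]) (L' := [4, 5, 7, 17]) (by decide)
      (by decide)).trans (hag₂.mono (by decide) (by decide))).trans
      ((hag₃.mono (by decide) (by decide)).trans (hag.mono (by decide) (by decide)))
    have hA' : toTensor n d (s'.mem 3) = A := by rw [hag'.mem 3 (by decide), hA]
    have e17 : s'.mem 17 0 = 1 - ∑ y, A y := by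
      rw [hag.mem 17 (by decide), hag₃.mem 17 (by decide), e₂, e₁,
        sum_range_pow (n := n) (d := d), ← hA]
      simp [toTensor, sub_eq_add_neg]
    refine (Ends.defectMode (h.of_agree hag' (by decide) (by decide)) hn ⟨k, hk⟩ hr3 hr4
      hA').mono le_rfl fun s'' _ e => ?_
    rw [e17, hI] at e
    refine e.trans ?_
    funext x
    rw [Finset.prod_range_succ, dif_pos hk]
    rfl
  · rw [hag₄.reg 2 (by decide), hag₃.reg 2 (by decide), hag₂.reg 2 (by decide),
      hag₁.reg 2 (by decide), h.size]
  · intro i s' hi hag hr h3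
    have e1 : s'.mem 3 i = s.mem 3 i := by
      rw [h3, hag₄.mem 3 (by decide), hag₃.mem 3 (by decide), hag₂.mem 3 (by decide),
        hag₁.mem 3 (by decide)]
    have e17 : s'.mem 17 0 = 1 - ∑ y, A y := by
      rw [hag.mem 17 (by decide), hag₄.mem 17 (by decide), hag₃.mem 17 (by decide), e₂, e₁,
        sum_range_pow (n := n) (d := d), ← hA]
      simp [toTensor, sub_eq_add_neg]
    simp [Prog.exec, NatExp.eval, RealExp.eval, hr, e1, e17, hag.mem 7 (by decide)]
  · funext x
    have e7 := congrFun e₄.2 x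
    simp only [toTensor] at e7
    rw [toTensor, e _ (address_lt x), e7, Finset.prod_range,
      show s.mem 3 (address x) = A x from congrFun hA x]
    simp [TOT.complete, f]
  · have : d * (200 * n ^ d + 12) = 200 * (d * n ^ d) + 12 * d := by ring
    have := Nat.mul_pos hd hN
    omega

/-- Approximately optimal transport by Sinkhorn scaling and rounding. -/
def Prog.transport : Prog :=
  .seq .computeSize <| .seq .computeConstants <| .seq .start <| .seq .sinkhorn <|
    .seq (.modes .shrinkMode) .complete

/-- The hypothesis `hm` states that `m` drops of size κ exhaust the bound for the initial potential.
-/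
theorem Ends.transport (hn : 1 ≤ n) (hd : 1 ≤ d) {P : Fin d → Fin n → ℝ}
    (hP : ∀ k, IsPosProbVec (P k)) {C : Tensor n d} {δ : ℝ} (hδ : 0 < δ) {s : State}
    (h : IsInput s P C δ) (m : ℕ)
    (hm : 2 * (d * Real.log (n + 1)) / δ * spread C + d * Real.log n ≤
      m * (δ / (4 * (d * max (spread C) δ))) ^ 2) :
    Ends .transport s ((m + 6) * (330 * (d * n ^ d))) (fun s' =>
      output n d s' ∈ contingency P ∧ inner C (output n d s') ≤ value C P + δ) := by
  have hN : 0 < n ^ d := by positivity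
  have hdN : d ≤ d * n ^ d := Nat.le_mul_of_pos_right _ hN
  have hdN' : n ^ d ≤ d * n ^ d := Nat.le_mul_of_pos_left _ hd
  have hP0 : ∀ k i, 0 ≤ P k i := fun k i => ((hP k).1 i).le
  have hη : 0 ≤ 2 * (d * Real.log (n + 1)) / δ := by
    have : 0 ≤ Real.log ((n : ℝ) + 1) := Real.log_nonneg (by linarith [Nat.cast_nonneg (α := ℝ) n])
    positivity
  have hκ : 0 < (δ / (4 * (d * max (spread C) δ))) ^ 2 := by
    have : 0 < max (spread C) δ := hδ.trans_le (le_max_right _ _)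
    have : (0 : ℝ) < d := by exact_mod_cast hd
    positivity
  refine Ends.mono ((Ends.computeSize h).seq fun s₁ _ h₁ =>
    (Ends.computeConstants h₁ hn).seq fun s₂ _ ⟨h₂, e13, e14⟩ =>
    (Ends.start h₂ hn).seq (U := (m + 2) * (330 * (d * n ^ d)) + 620 * (d * n ^ d))
      fun s₃ hag₃ h₃ => ?_) (T := 14 * d + 10 + (300 * n ^ d + (100 * n ^ d +
        ((m + 2) * (330 * (d * n ^ d)) + 620 * (d * n ^ d))))) ?_ fun _ _ h => h
  · have e14' : s₃.mem 14 0 = (δ / (4 * (d * max (spread C) δ))) ^ 2 := by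
      rw [hag₃.mem 14 (by decide), e14]
    have hG := isGibbs_gibbsStart hn (s₂.mem 13 0) C
    rw [e13] at h₃ hG
    rw [← h₃] at hG
    refine Ends.mono_time ((Ends.sinkhorn (h₂.of_agree hag₃ (by decide) (by decide)) hP hn hd
      (e14' ▸ hκ) hG m ?_).seq fun s₄ _ ⟨h₄, hG', hrel⟩ => (Ends.shrink h₄ hn hd rfl).seq fun s₅ _ ⟨h₅, e₅⟩ =>
        (Ends.complete h₅ hn hd e₅).mono le_rfl fun s' _ e => ?_)
        (by omega)
    · rw [h₃, e14']
      exact (potential_gibbsStart_le hn hd hη C hP).trans hm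
    · have e' : output n d s' = TOT.complete P (TOT.shrink P (toTensor n d (s₄.mem 3)) d) := e
      have hA : ∀ x, 0 ≤ toTensor n d (s₄.mem 3) x := fun x => (hG'.pos x).le
      rw [e']
      exact ⟨complete_mem hd (fun k => (hP k).2) (shrink_nonneg hP0 hA d)
        (marginal_shrink_le hP0 hA), inner_complete_shrink_le_value hn hd hP hδ rfl rfl rfl hG'
        (by rwa [e14'] at hrel)⟩
  -- Scaling accounts for `m + 2` units; the other four cover the preparation and the rounding,
  -- which costs 220 + 400 = 620 times `d * n ^ d`.
  · have : (m + 6) * (330 * (d * n ^ d)) = (m + 2) * (330 * (d * n ^ d)) + 1320 * (d * n ^ d) := by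
      ring
    omega

/-! ### Counting the operations -/

theorem rounds_bound (hn : 2 ≤ n) (hd : 1 ≤ d) {ω δ : ℝ} (hδ : 0 < δ) :
    (2 * (d * Real.log (n + 1)) / δ * ω + d * Real.log n) /
      (δ / (4 * (d * max ω δ))) ^ 2 + 7 ≤ 108 * (d ^ 3 * Real.log n * (max ω δ / δ) ^ 3) := by
  have hn' : (2 : ℝ) ≤ n := by exact_mod_cast hn
  have hd' : (1 : ℝ) ≤ d := by exact_mod_cast hd
  set M := max ω δ with hM
  have hMδ : δ ≤ M := le_max_right _ _
  have hMω : ω ≤ M := le_max_left _ _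
  have hM0 : 0 < M := hδ.trans_le hMδ
  -- Additive constants are absorbed into log n, which is where `n ≥ 2` is needed; it also gives n +
  -- 1 ≤ n² in the next step.
  have hlog : 1 / 2 ≤ Real.log n :=
    (by linarith [Real.log_two_gt_d9] : 1 / 2 ≤ Real.log 2).trans
      (Real.log_le_log (by norm_num) hn')
  have hlog' : Real.log (n + 1) ≤ 2 * Real.log n := by
    have h1 : 2 * Real.log n = Real.log ((n : ℝ) ^ 2) := by rw [Real.log_pow]; norm_num
    rw [h1]
    exact Real.log_le_log (by linarith) (by nlinarith)
  set L := Real.log n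
  have hr : 1 ≤ M / δ := (one_le_div hδ).2 hMδ
  have h1 : 2 * (d * Real.log (n + 1)) / δ * ω + d * L ≤ 5 * (d * L * (M / δ)) := by
    have h2 : 2 * (d * Real.log (n + 1)) / δ * ω ≤ 4 * (d * L * (M / δ)) := by
      have h3 : 0 ≤ Real.log ((n : ℝ) + 1) := Real.log_nonneg (by linarith)
      calc 2 * (d * Real.log (n + 1)) / δ * ω ≤ 2 * (d * Real.log (n + 1)) / δ * M := by gcongr
        _ ≤ 2 * (d * (2 * L)) / δ * M := by gcongr
        _ = 4 * (d * L * (M / δ)) := by ring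
    have h4 : d * L ≤ d * L * (M / δ) := le_mul_of_one_le_right (by positivity) hr
    linarith
  -- The factor is 80 = 5 · 4²: one d and one M/δ come from the potential, two more of each from
  -- 1/κ. The added 7 is at most 14 times the bound, so 108 leaves room.
  have h5 : (2 * (d * Real.log (n + 1)) / δ * ω + d * L) / (δ / (4 * (d * M))) ^ 2 ≤
      80 * (d ^ 3 * L * (M / δ) ^ 3) := by
    rw [div_le_iff₀ (by positivity)]
    refine h1.trans_eq ?_
    field_simp
    ring
  have h6 : 1 / 2 ≤ d ^ 3 * L * (M / δ) ^ 3 := by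
    have h7 : 1 ≤ (d : ℝ) ^ 3 := one_le_pow₀ hd'
    have h8 : 1 ≤ (M / δ) ^ 3 := one_le_pow₀ hr
    calc 1 / 2 ≤ L := hlog
      _ ≤ d ^ 3 * L := le_mul_of_one_le_left (by linarith) h7
      _ ≤ d ^ 3 * L * (M / δ) ^ 3 := le_mul_of_one_le_right (by positivity) h8
  linarith

end TOT

end

/-- One program and one constant `K` serve all dimensions and all inputs. -/
theorem mainTheorem1 :
    ∃ (prog : TOT.Prog) (K : ℝ), ∀ (n d : ℕ), 1 ≤ n → 1 ≤ d →
      ∀ (P : Fin d → Fin n → ℝ), (∀ k, TOT.IsPosProbVec (P k)) →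
      ∀ (C : TOT.Tensor n d) (δ : ℝ), 0 < δ →
      ∀ s : TOT.State, TOT.IsInput s P C δ →
      ∃ (s' : TOT.State) (t : ℕ), TOT.Runs prog s s' t ∧
        TOT.output n d s' ∈ TOT.contingency P ∧
        TOT.inner C (TOT.output n d s') ≤ TOT.value C P + δ ∧
        (2 ≤ n → (t : ℝ) ≤
          K * ((max (TOT.spread C) δ) ^ 3 * (d : ℝ) ^ 4 * (n : ℝ) ^ (d + 1) * Real.log n / δ ^ 3)) := by
  refine ⟨.transport, 330 * 108, fun n d hn hd P hP C δ hδ s hs => ?_⟩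
  have hκ : 0 < (δ / (4 * (d * max (TOT.spread C) δ))) ^ 2 := by
    have : 0 < max (TOT.spread C) δ := hδ.trans_le (le_max_right _ _)
    have : (0 : ℝ) < d := by exact_mod_cast hd
    positivity
  set Φ := 2 * (d * Real.log (n + 1)) / δ * TOT.spread C + d * Real.log n with hΦ
  set κ := (δ / (4 * (d * max (TOT.spread C) δ))) ^ 2 with hκ'
  obtain ⟨s', t, hr, ht, hmem, hval⟩ := TOT.Ends.transport hn hd hP hδ hs ⌈Φ / κ⌉₊
    ((div_le_iff₀ hκ).1 (Nat.le_ceil _))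
  refine ⟨s', t, hr, hmem, hval, fun hn2 => ?_⟩
  have hb := TOT.rounds_bound hn2 hd (ω := TOT.spread C) hδ
  rw [← hΦ, ← hκ'] at hb
  -- Nonnegativity is needed for the ceiling to exceed `Φ / κ` by at most one; this one and the 6
  -- overhead units make the 7 of `rounds_bound`.
  have hΦ0 : 0 ≤ Φ := by
    have h1 : 0 ≤ Real.log ((n : ℝ) + 1) :=
      Real.log_nonneg (by linarith [Nat.cast_nonneg (α := ℝ) n])
    have h2 : 0 ≤ TOT.spread C := by
      simpa using TOT.sub_le_spread C (fun _ => ⟨0, hn⟩) (fun _ => ⟨0, hn⟩)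
    have h3 : 0 ≤ Real.log n := Real.log_natCast_nonneg n
    positivity
  have hceil := (Nat.ceil_lt_add_one (div_nonneg hΦ0 hκ.le)).le
  have hn' : (1 : ℝ) ≤ n := by exact_mod_cast hn
  set q := (d : ℝ) ^ 3 * Real.log n * (max (TOT.spread C) δ / δ) ^ 3 with hq
  have hq0 : 0 ≤ q := by
    have := div_nonneg hΦ0 hκ.le
    linarith
  calc (t : ℝ) ≤ ((⌈Φ / κ⌉₊ + 6) * (330 * (d * n ^ d)) : ℕ) := by exact_mod_cast ht
    _ = (⌈Φ / κ⌉₊ + 6) * (330 * (d * (n : ℝ) ^ d)) := by push_cast; ring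
    _ ≤ (108 * q) * (330 * (d * (n : ℝ) ^ d)) := by gcongr; linarith
    -- A factor `n` is given away: the count obtained is in fact of order n^d.
    _ ≤ (108 * q) * (330 * (d * (n : ℝ) ^ (d + 1))) := by
      gcongr
      omega
    _ = _ := by rw [hq, div_pow]; ring
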